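/- Let $\mathcal X$ be a finite or countably infinite set, $K$ an irreducible Markov kernel on $\mathcal X$ (so $\sum_y K(x,y)=1$ for all $x$), and $\pi$ a probability measure with $K(x,y)\pi(x)=K(y,x)\pi(y)$ for all $x,y$. Put $J:=\sup_x(1-K(x,x))$, and let $d$ be the graph distance of the graph on $\mathcal X$ in which $x\ne y$ are adjacent when $K(x,y)>0$. Let $Lf(x)=\sum_y(f(y)-f(x))K(x,y)$, $\Gamma(f,g)(x)=\frac12\sum_y(f(y)-f(x))(g(y)-g(x))K(x,y)$, $\Gamma(f)=\Gamma(f,f)$, and $$\widetilde\Gamma_2(f)=\tfrac12 L\Gamma(f)-\Gamma(f,Lf)-\Gamma\Big(f,\frac{\Gamma(f)}{f}\Big).$$ Assume the exponential curvature condition $CDE'(\kappa_e,\infty)$ with $\kappa_e>0$: $\widetilde\Gamma_2(f)(x)\ge\kappa_e\Gamma(f)(x)$ for all $x\in\mathcal X$ and all $f:\mathcal X\to\mathbb R$ that are bounded and bounded below by a positive constant. For probability measures $\mu,\nu$ on $\mathcal X$ let $$\widetilde W_2(\nu|\mu)^2=\inf\int\Big(\int d(x,y)\,p_x(dy)\Big)^2\mu(dx)\in[0,\infty],$$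 the infimum being over all couplings $p_x(dy)\mu(dx)$ with first marginal $\mu$ and second marginal $\nu$. Theorem 4.3. For every $f\ge0$ with $\int f\,d\pi=1$, $$\widetilde W_2(\pi|f\pi)^2\le\frac{2J}{\kappa_e^2}\,\overline{\mathcal I}_\pi(f),\qquad \overline{\mathcal I}_\pi(f):=\int\frac{\Gamma(f)}{f}\,d\pi\in[0,\infty],$$ and the same bound holds for $\widetilde W_2(f\pi|\pi)^2$ (here $a/0=\infty$ for $a>0$ and $0/0=0$). -/

import Mathlib

open scoped ENNReal

noncomputable section

namespace DiscreteChain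

variable {X : Type*}

/-- A Markov kernel `K` (each row `K x` is a probability vector) is irreducible if every state
can be reached from every other one through transitions of positive probability. -/
def Irreducible (K : X → PMF X) : Prop :=
  ∀ x y, Relation.ReflTransGen (fun a b => 0 < K a b) x y

/-- Detailed balance: `π` is a reversible (hence invariant) probability for `K`. -/
def Reversible (K : X → PMF X) (π : PMF X) : Prop :=
  ∀ x y, K x y * π x = K y x * π y

/-- `J = sup_x (1 - K(x,x))`. -/
def jumpRate (K : X → PMF X) : ℝ := ⨆ x, (1 - (K x x).toReal)

/-- The generator `Lf(x) = ∑_y (f(y) - f(x)) K(x,y)`. -/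
def gen (K : X → PMF X) (f : X → ℝ) (x : X) : ℝ :=
  ∑' y, (f y - f x) * (K x y).toReal

/-- `Γ(f,g)(x) = 1/2 ∑_y (f(y) - f(x)) (g(y) - g(x)) K(x,y)`. -/
def Gam (K : X → PMF X) (f g : X → ℝ) (x : X) : ℝ :=
  (1 / 2) * ∑' y, (f y - f x) * (g y - g x) * (K x y).toReal

/-- `Γ₂(f) = 1/2 L Γ(f) - Γ(f, Lf)`. -/
def Gam2 (K : X → PMF X) (f : X → ℝ) (x : X) : ℝ :=
  (1 / 2) * gen K (Gam K f f) x - Gam K f (gen K f) x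

/-- `Γ̃₂(f) = Γ₂(f) - Γ(f, Γ(f)/f)`. -/
def Gam2Mod (K : X → PMF X) (f : X → ℝ) (x : X) : ℝ :=
  Gam2 K f x - Gam K f (fun z => Gam K f f z / f z) x

/-- The exponential curvature condition `CDE'(κ, ∞)`. It is required of the functions with
`0 < c ≤ f ≤ C` for some constants `c`, `C`: for these every sum and quotient that enters is
finite (all series converge absolutely, also when a state has infinitely many neighbours). At a
given `x` a positive function on a locally finite graph can be replaced by such a function without
changing either side, so that there the condition says the same for all positive functions. -/
def CDEPrime (K : X → PMF X) (κ : ℝ) : Prop :=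
  ∀ f : X → ℝ, (∃ c > 0, ∀ x, c ≤ f x) → (∃ C, ∀ x, f x ≤ C) →
    ∀ x, κ * Gam K f f x ≤ Gam2Mod K f x

/-- The graph on `X` with an edge between `x ≠ y` when `K(x,y) > 0` (or `K(y,x) > 0`, which is
the same thing for a reversible irreducible kernel). -/
def graph (K : X → PMF X) : SimpleGraph X :=
  SimpleGraph.fromRel (fun x y => 0 < K x y)

/-- The weak transport cost `T̃₂(ν|μ) = W̃₂(ν|μ)²` for the distance `d`: the infimum of
`∫ (∫ d(x,y) p_x(dy))² μ(dx)` over the couplings `p_x(dy) μ(dx)` with first marginal `μ` and second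
marginal `ν`. The second argument, `ν`, is the target; the third, `μ`, is the source. -/
def weakCost (d : X → X → ℝ≥0∞) (ν μ : PMF X) : ℝ≥0∞ :=
  ⨅ (p : X → PMF X) (_ : μ.bind p = ν), ∑' x, μ x * (∑' y, d x y * p x y) ^ 2

/-- The weak transport cost `W̃₂(ν|μ)²` for the graph distance of `K`. -/
def graphWeakCost (K : X → PMF X) (ν μ : PMF X) : ℝ≥0∞ :=
  weakCost (fun x y => ((graph K).dist x y : ℝ≥0∞)) ν μ

/-- `Γ(f)(x)` with values in `[0,∞]`, for arbitrary `f`. -/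
def eGam (K : X → PMF X) (f : X → ℝ) (x : X) : ℝ≥0∞ :=
  (1 / 2) * ∑' y, ENNReal.ofReal ((f y - f x) ^ 2) * K x y

/-- The modified Fisher information `Ī_π(f) = ∫ Γ(f)/f dπ` in `[0,∞]`, where `a/0 = ∞` for `a > 0`
and `0/0 = 0`. -/
def fisherBar (K : X → PMF X) (π : PMF X) (f : X → ℝ) : ℝ≥0∞ :=
  ∑' x, eGam K f x / ENNReal.ofReal (f x) * π x

end DiscreteChain

end

/-! The density is carried to 1 by the heat flow, and the transport cost along the way is summed.
Write h = Γ(f)/f. Since LΓ(f) = L(fh) = f Lh + h Lf + 2Γ(f,h), the mixed term in the modified Γ₂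
cancels 2Γ(f,h), and the curvature condition becomes ∂ₜh ≤ Lh - 2κh along ∂ₜf = Lf
(`CDEPrime.le_gen_fish`). Integrating against π gives decay of the Fisher information at rate 2κ;
the maximum principle gives the same decay for sup h.

The flow sends mass π(x)K(x,y)(f(x)-f(y))⁺ per unit time from x to the neighbour y. By
Cauchy-Schwarz, using only the jump probability 1-K(x,x) ≤ J, the squared weak cost of a time step ε
is at most about 2Jε² times the current Fisher information. The square root of the weak cost
satisfies the triangle inequality (`Link.trans`), so the total is √(2J I) ∫ exp(-κt) dt = √(2J I)/κ,
in both directions by reversibility.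

Time is discretised: explicit Euler steps f + εLf preserve bounds c ≤ f ≤ C, and their second-order
error is itself bounded by a multiple of Ph + h, where P averages over K, so it only turns κ into a
slightly smaller κ' (`CDEPrime.exists_contraction`). All losses are absorbed because the bound is
proved for every θ above the target.

The chain of couplings stops after finitely many steps, so the remainder must be closed up. Decay of
sup h bounds the oscillation of f (`CDEPrime.osc_le`). Applied to a truncated distance function this
gives finite diameter; applied to the iterates it gives uniform convergence to 1. On a graph of
finite diameter, L¹-close densities have small weak cost. The same remark removes the bounds on f:
truncation does not increase the Fisher information, and normalising costs a factor tending to 1. -/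

namespace DiscreteChain

variable {X : Type*}

/-! ### Bounded functions and their means -/

/-- A real function is bounded. -/
def Bounded (u : X → ℝ) : Prop := ∃ C, ∀ x, |u x| ≤ C

/-- The mean of `u` under `p`. -/
noncomputable def expect (p : PMF X) (u : X → ℝ) : ℝ := ∑' y, u y * (p y).toReal

namespace Bounded

variable {u v : X → ℝ}

theorem const (a : ℝ) : Bounded (fun _ : X => a) := ⟨|a|, fun _ => le_rfl⟩

theorem add (hu : Bounded u) (hv : Bounded v) : Bounded (fun x => u x + v x) := by
  obtain ⟨A, hA⟩ := hu
  obtain ⟨B, hB⟩ := hv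
  exact ⟨A + B, fun x => (abs_add_le _ _).trans (add_le_add (hA x) (hB x))⟩

theorem sub (hu : Bounded u) (hv : Bounded v) : Bounded (fun x => u x - v x) := by
  obtain ⟨A, hA⟩ := hu
  obtain ⟨B, hB⟩ := hv
  exact ⟨A + B, fun x => (abs_sub _ _).trans (add_le_add (hA x) (hB x))⟩

theorem mul (hu : Bounded u) (hv : Bounded v) : Bounded (fun x => u x * v x) := by
  obtain ⟨A, hA⟩ := hu
  obtain ⟨B, hB⟩ := hv
  refine ⟨A * B, fun x => ?_⟩
  rw [abs_mul]
  exact mul_le_mul (hA x) (hB x) (abs_nonneg _) ((abs_nonneg _).trans (hA x))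

theorem const_mul (a : ℝ) (hu : Bounded u) : Bounded (fun x => a * u x) := (const a).mul hu

theorem sq (hu : Bounded u) : Bounded (fun x => u x ^ 2) := by
  simpa only [pow_two] using hu.mul hu

theorem of_mem_Icc {a b : ℝ} (h : ∀ x, a ≤ u x ∧ u x ≤ b) : Bounded u :=
  ⟨max |a| |b|, fun x => abs_le_max_abs_abs (h x).1 (h x).2⟩

theorem inv_of_le {c : ℝ} (hc : 0 < c) (h : ∀ x, c ≤ u x) : Bounded (fun x => (u x)⁻¹) :=
  of_mem_Icc (a := 0) (b := c⁻¹) fun x =>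
    ⟨inv_nonneg.2 (hc.le.trans (h x)), inv_anti₀ hc (h x)⟩

end Bounded

theorem summable_toReal (p : PMF X) : Summable (fun y => (p y).toReal) :=
  ENNReal.summable_toReal p.tsum_coe_ne_top

theorem tsum_toReal (p : PMF X) : ∑' y, (p y).toReal = 1 := by
  rw [← ENNReal.tsum_toReal_eq (fun y => p.apply_ne_top y), p.tsum_coe, ENNReal.toReal_one]

theorem Bounded.summable {u : X → ℝ} (hu : Bounded u) (p : PMF X) :
    Summable (fun y => u y * (p y).toReal) := by
  obtain ⟨C, hC⟩ := hu
  refine Summable.of_norm_bounded ((summable_toReal p).mul_left C) fun y => ?_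
  rw [norm_mul, Real.norm_eq_abs, Real.norm_of_nonneg ENNReal.toReal_nonneg]
  exact mul_le_mul_of_nonneg_right (hC y) ENNReal.toReal_nonneg

section expect

variable (p : PMF X) {u v : X → ℝ}

theorem expect_const (a : ℝ) : expect p (fun _ => a) = a := by
  rw [expect, tsum_mul_left, tsum_toReal, mul_one]

theorem expect_add (hu : Bounded u) (hv : Bounded v) :
    expect p (fun x => u x + v x) = expect p u + expect p v := by
  simp only [expect, add_mul]
  exact (hu.summable p).tsum_add (hv.summable p)

theorem expect_sub (hu : Bounded u) (hv : Bounded v) :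
    expect p (fun x => u x - v x) = expect p u - expect p v := by
  simp only [expect, sub_mul]
  exact (hu.summable p).tsum_sub (hv.summable p)

theorem expect_const_mul (a : ℝ) (u : X → ℝ) :
    expect p (fun x => a * u x) = a * expect p u := by
  simp only [expect, mul_assoc]
  exact tsum_mul_left

theorem expect_mono (hu : Bounded u) (hv : Bounded v) (h : ∀ x, u x ≤ v x) :
    expect p u ≤ expect p v :=
  (hu.summable p).tsum_le_tsum
    (fun x => mul_le_mul_of_nonneg_right (h x) ENNReal.toReal_nonneg) (hv.summable p)

theorem expect_nonneg (h : ∀ x, 0 ≤ u x) : 0 ≤ expect p u :=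
  tsum_nonneg fun x => mul_nonneg (h x) ENNReal.toReal_nonneg

theorem le_expect {a : ℝ} (hu : Bounded u) (h : ∀ x, a ≤ u x) : a ≤ expect p u := by
  simpa only [expect_const] using expect_mono p (Bounded.const a) hu h

theorem expect_le {a : ℝ} (hu : Bounded u) (h : ∀ x, u x ≤ a) : expect p u ≤ a := by
  simpa only [expect_const] using expect_mono p hu (Bounded.const a) h

theorem mul_toReal_le_expect (hu : Bounded u) (h : ∀ x, 0 ≤ u x) (x : X) :
    u x * (p x).toReal ≤ expect p u :=
  (hu.summable p).le_tsum x fun y _ => mul_nonneg (h y) ENNReal.toReal_nonneg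

/-- Cauchy-Schwarz: the quadratic t ↦ E(tu + v)² is nonnegative, so its discriminant is not
positive. -/
theorem sq_expect_mul_le (hu : Bounded u) (hv : Bounded v) :
    expect p (fun x => u x * v x) ^ 2 ≤
      expect p (fun x => u x ^ 2) * expect p (fun x => v x ^ 2) := by
  have key : ∀ t : ℝ, 0 ≤ expect p (fun x => u x ^ 2) * (t * t) +
      2 * expect p (fun x => u x * v x) * t + expect p (fun x => v x ^ 2) := by
    intro t
    have h0 : 0 ≤ expect p (fun x => (t * t) * u x ^ 2 + (2 * t) * (u x * v x) + v x ^ 2) :=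
      expect_nonneg p fun x => by nlinarith [sq_nonneg (t * u x + v x)]
    rw [expect_add p ((hu.sq.const_mul _).add ((hu.mul hv).const_mul _)) hv.sq,
      expect_add p (hu.sq.const_mul _) ((hu.mul hv).const_mul _), expect_const_mul,
      expect_const_mul] at h0
    linarith
  have := discrim_le_zero key
  rw [discrim] at this
  linarith

theorem sq_expect_le (hu : Bounded u) : expect p u ^ 2 ≤ expect p (fun x => u x ^ 2) := by
  simpa only [mul_one, one_pow, expect_const] using sq_expect_mul_le p hu (Bounded.const 1)

theorem ofReal_expect (hu : Bounded u) (h : ∀ x, 0 ≤ u x) :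
    ENNReal.ofReal (expect p u) = ∑' x, ENNReal.ofReal (u x) * p x := by
  rw [expect, ENNReal.ofReal_tsum_of_nonneg
    (fun x => mul_nonneg (h x) ENNReal.toReal_nonneg) (hu.summable p)]
  refine tsum_congr fun x => ?_
  rw [ENNReal.ofReal_mul (h x), ENNReal.ofReal_toReal (p.apply_ne_top x)]

theorem Bounded.expect (hu : Bounded u) (K : X → PMF X) :
    Bounded (fun x => expect (K x) u) := by
  obtain ⟨C, hC⟩ := hu
  exact .of_mem_Icc fun x => ⟨le_expect _ ⟨C, hC⟩ fun y => (abs_le.1 (hC y)).1,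
    expect_le _ ⟨C, hC⟩ fun y => (abs_le.1 (hC y)).2⟩

theorem expect_bind (K : X → PMF X) (hu : Bounded u) :
    expect (p.bind K) u = expect p (fun x => expect (K x) u) := by
  have nonneg_case : ∀ v : X → ℝ, Bounded v → (∀ x, 0 ≤ v x) →
      expect (p.bind K) v = expect p (fun x => expect (K x) v) := by
    intro v hv h
    have h2 : ∀ x, 0 ≤ DiscreteChain.expect (K x) v := fun x => expect_nonneg _ h
    rw [← ENNReal.ofReal_eq_ofReal_iff (expect_nonneg _ h) (expect_nonneg _ h2),
      ofReal_expect _ hv h, ofReal_expect _ (hv.expect K) h2]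
    simp only [ofReal_expect _ hv h, PMF.bind_apply, ← ENNReal.tsum_mul_left,
      ← ENNReal.tsum_mul_right]
    rw [ENNReal.tsum_comm]
    exact tsum_congr fun x => tsum_congr fun y => by ring
  -- Adding the constant C makes u nonnegative, where sums in [0,∞] may be exchanged freely; the
  -- constant has the same mean on both sides.
  obtain ⟨C, hC⟩ := hu
  have hu : Bounded u := ⟨C, hC⟩
  have h := nonneg_case (fun x => u x + C) (hu.add (.const C))
    fun x => by linarith [(abs_le.1 (hC x)).1]
  rw [expect_add _ hu (.const C), expect_const] at h
  simp only [expect_add _ hu (.const C), expect_const] at h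
  rw [expect_add _ (hu.expect K) (.const C), expect_const] at h
  linarith

end expect

theorem Reversible.bind_eq {K : X → PMF X} {π : PMF X} (h : Reversible K π) : π.bind K = π := by
  ext y
  rw [PMF.bind_apply]
  calc ∑' x, π x * K x y = ∑' x, K y x * π y := tsum_congr fun x => by rw [mul_comm, h x y]
    _ = π y := by rw [ENNReal.tsum_mul_right, PMF.tsum_coe, one_mul]

theorem Reversible.expect_expect {K : X → PMF X} {π : PMF X} (h : Reversible K π) {u : X → ℝ}
    (hu : Bounded u) : expect π (fun x => expect (K x) u) = expect π u := by
  rw [← expect_bind π K hu, h.bind_eq]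

/-! ### Calculus of the generator and of Γ -/

/-- The pointwise density `Γ(f)/f` of the modified Fisher information. -/
noncomputable def fish (K : X → PMF X) (f : X → ℝ) (x : X) : ℝ := Gam K f f x / f x

/-- The explicit Euler step `f + ε L f` for the heat equation. -/
noncomputable def euler (K : X → PMF X) (ε : ℝ) (f : X → ℝ) (x : X) : ℝ := f x + ε * gen K f x

section operators

variable (K : X → PMF X) {f g : X → ℝ}

theorem gen_eq (hf : Bounded f) (x : X) : gen K f x = expect (K x) f - f x := by
  change expect (K x) (fun y => f y - f x) = _
  rw [expect_sub _ hf (.const _), expect_const]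

theorem Gam_eq_expect (f g : X → ℝ) (x : X) :
    Gam K f g x = (1 / 2) * expect (K x) (fun y => (f y - f x) * (g y - g x)) := rfl

theorem Gam_eq (hf : Bounded f) (hg : Bounded g) (x : X) :
    Gam K f g x = (1 / 2) * (expect (K x) (fun y => f y * g y) - f x * expect (K x) g
      - g x * expect (K x) f + f x * g x) := by
  have : (fun y => (f y - f x) * (g y - g x)) =
      fun y => f y * g y - f x * g y - g x * f y + f x * g x := by
    ext y; ring
  rw [Gam_eq_expect, this, expect_add _ (((hf.mul hg).sub (hg.const_mul _)).sub (hf.const_mul _))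
    (.const _), expect_sub _ ((hf.mul hg).sub (hg.const_mul _)) (hf.const_mul _),
    expect_sub _ (hf.mul hg) (hg.const_mul _), expect_const, expect_const_mul, expect_const_mul]

theorem Bounded.gen (hf : Bounded f) : Bounded (gen K f) := by
  rw [funext (gen_eq K hf)]
  exact (hf.expect K).sub hf

theorem Bounded.Gam (hf : Bounded f) (hg : Bounded g) : Bounded (Gam K f g) := by
  rw [funext (Gam_eq K hf hg)]
  exact (((((hf.mul hg).expect K).sub (hf.mul (hg.expect K))).sub
    (hg.mul (hf.expect K))).add (hf.mul hg)).const_mul _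

theorem Gam_self_nonneg (f : X → ℝ) (x : X) : 0 ≤ Gam K f f x :=
  mul_nonneg (by norm_num) (expect_nonneg _ fun y => mul_self_nonneg _)

theorem Gam_self_add_smul (hf : Bounded f) (hg : Bounded g) (t : ℝ) (x : X) :
    Gam K (fun y => f y + t * g y) (fun y => f y + t * g y) x =
      Gam K f f x + 2 * t * Gam K f g x + t ^ 2 * Gam K g g x := by
  have e : (fun y => (f y + t * g y - (f x + t * g x)) * (f y + t * g y - (f x + t * g x))) =
      fun y => (f y - f x) * (f y - f x) + (2 * t) * ((f y - f x) * (g y - g x)) +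
        t ^ 2 * ((g y - g x) * (g y - g x)) := by
    ext y; ring
  have bf := hf.sub (.const (f x))
  have bg := hg.sub (.const (g x))
  rw [Gam_eq_expect, e, expect_add _ ((bf.mul bf).add ((bf.mul bg).const_mul _))
    ((bg.mul bg).const_mul _), expect_add _ (bf.mul bf) ((bf.mul bg).const_mul _),
    expect_const_mul, expect_const_mul, Gam_eq_expect, Gam_eq_expect, Gam_eq_expect]
  ring

/-- Jensen: Lf is the mean of the increments of f, and 2Γ(f) the mean of their squares. -/
theorem sq_gen_le (hf : Bounded f) (x : X) : gen K f x ^ 2 ≤ 2 * Gam K f f x := by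
  have h := sq_expect_le (K x) (hf.sub (.const (f x)))
  rw [Gam_eq_expect]
  simp only [← pow_two]
  change gen K f x ^ 2 ≤ _ at h
  linarith

theorem Gam_self_le (hf : Bounded f) (x : X) :
    Gam K f f x ≤ expect (K x) (fun y => f y ^ 2) + f x ^ 2 := by
  have b := hf.sub (.const (f x))
  have h : expect (K x) (fun y => (f y - f x) * (f y - f x)) ≤
      expect (K x) (fun y => 2 * f y ^ 2 + 2 * f x ^ 2) :=
    expect_mono _ (b.mul b) ((hf.sq.const_mul 2).add (.const _))
      fun y => by nlinarith [sq_nonneg (f y + f x)]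
  rw [expect_add _ (hf.sq.const_mul 2) (.const _), expect_const, expect_const_mul] at h
  rw [Gam_eq_expect]
  linarith

end operators

/-! ### Curvature along an Euler step -/

/-- `f` takes values in `[c, C]`. -/
def Between (c C : ℝ) (f : X → ℝ) : Prop := ∀ x, c ≤ f x ∧ f x ≤ C

section step

variable {K : X → PMF X} {f : X → ℝ} {c C : ℝ}

theorem Between.bounded (hf : Between c C f) : Bounded f := .of_mem_Icc hf

theorem Between.bounded_fish (hc : 0 < c) (hf : Between c C f) : Bounded (fish K f) := by
  have : fish K f = fun x => Gam K f f x * (f x)⁻¹ := funext fun x => div_eq_mul_inv _ _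
  rw [this]
  exact (hf.bounded.Gam K hf.bounded).mul (.inv_of_le hc fun x => (hf x).1)

theorem Between.fish_nonneg (hc : 0 < c) (hf : Between c C f) (x : X) : 0 ≤ fish K f x :=
  div_nonneg (Gam_self_nonneg K f x) (hc.le.trans (hf x).1)

/-- The step is the convex combination (1-ε)f + εPf, with Pf the average of f over K. -/
theorem Between.euler_step (hf : Between c C f) {ε : ℝ} (h0 : 0 ≤ ε) (h1 : ε ≤ 1) :
    Between c C (euler K ε f) := by
  intro x
  have hl := le_expect (K x) hf.bounded fun y => (hf y).1
  have hu := expect_le (K x) hf.bounded fun y => (hf y).2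
  rw [euler, gen_eq K hf.bounded]
  constructor <;> nlinarith [(hf x).1, (hf x).2]

/-- The left side is the time derivative of h = Γ(f)/f along the heat flow, the right side is Lh -
2κh. Expanding LΓ(f) = L(fh) by the product rule produces 2Γ(f,h), which is exactly what the
correction in Γ̃₂ removes. -/
theorem CDEPrime.le_gen_fish {κ : ℝ} (h : CDEPrime K κ) (hc : 0 < c) (hf : Between c C f)
    (x : X) : 2 * Gam K f (gen K f) x / f x - fish K f x * gen K f x / f x ≤
      expect (K x) (fish K f) - fish K f x - 2 * κ * fish K f x := by
  have key := h f ⟨c, hc, fun x => (hf x).1⟩ ⟨C, fun x => (hf x).2⟩ x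
  have bf := hf.bounded
  have bh : Bounded (fish K f) := hf.bounded_fish hc
  have pos : ∀ y, 0 < f y := fun y => hc.trans_le (hf y).1
  have eG : Gam K f f = fun y => f y * fish K f y := funext fun y => by
    rw [fish, mul_div_cancel₀ _ (pos y).ne']
  change κ * Gam K f f x ≤ Gam2 K f x - Gam K f (fish K f) x at key
  rw [Gam2, Gam_eq K bf bh, gen_eq K (bf.Gam K bf), eG] at key
  rw [← sub_div, div_le_iff₀ (pos x), gen_eq K bf]
  linarith

/-- An exact expansion, not a Taylor estimate: with t = Lf(x)/f(x) frozen, the ε² numerator is Γ(Lf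
- tf)(x). -/
theorem fish_euler_eq (hf : Bounded f) {ε : ℝ} {x : X} (h : f x ≠ 0) (h' : euler K ε f x ≠ 0) :
    fish K (euler K ε f) x = fish K f x +
      ε * (2 * Gam K f (gen K f) x / f x - fish K f x * gen K f x / f x) +
      ε ^ 2 * ((Gam K (gen K f) (gen K f) x
        - 2 * (gen K f x / f x) * Gam K f (gen K f) x
        + (gen K f x / f x) ^ 2 * Gam K f f x) / euler K ε f x) := by
  have e : Gam K (euler K ε f) (euler K ε f) x = _ :=
    Gam_self_add_smul K hf (hf.gen K) ε x
  rw [fish, e, fish]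
  field_simp
  rw [euler]
  ring

/-- Parallelogram identity for Γ, with the term Γ(g + tf) ≥ 0 dropped. -/
theorem two_mul_Gam_le (hf : Bounded f) {g : X → ℝ} (hg : Bounded g) (t : ℝ) (x : X) :
    Gam K g g x - 2 * t * Gam K f g x + t ^ 2 * Gam K f f x ≤
      2 * Gam K g g x + 2 * (t ^ 2 * Gam K f f x) := by
  have h1 := Gam_self_add_smul K hg hf t x
  have h2 := Gam_self_nonneg K (fun y => g y + t * f y) x
  have h3 : Gam K g f x = Gam K f g x := by simp only [Gam, mul_comm]
  rw [h1, h3] at h2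
  linarith

/-- One Euler step under the curvature condition; the error is of second order in the step. -/
theorem CDEPrime.fish_euler_le {κ : ℝ} (h : CDEPrime K κ) (hc : 0 < c) (hf : Between c C f)
    {ε : ℝ} (h0 : 0 ≤ ε) (h1 : ε ≤ 1) (x : X) :
    fish K (euler K ε f) x ≤ fish K f x +
      ε * (expect (K x) (fish K f) - fish K f x - 2 * κ * fish K f x) +
      ε ^ 2 * (2 * (2 * C + (C / c) ^ 2 * C) / c * (expect (K x) (fish K f) + fish K f x)) := by
  have bf := hf.bounded
  have bg := bf.gen K
  have bh : Bounded (fish K f) := hf.bounded_fish hc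
  have pos : ∀ y, 0 < f y := fun y => hc.trans_le (hf y).1
  have hC : 0 < C := (pos x).trans_le (hf x).2
  have he := hf.euler_step (K := K) h0 h1 x
  have hnn : ∀ y, 0 ≤ fish K f y := hf.fish_nonneg hc
  have hP : 0 ≤ expect (K x) (fish K f) := expect_nonneg _ hnn
  have eG : ∀ y, Gam K f f y = f y * fish K f y := fun y => by
    rw [fish, mul_div_cancel₀ _ (pos y).ne']
  have leG : ∀ y, Gam K f f y ≤ C * fish K f y := fun y => by
    rw [eG]; exact mul_le_mul_of_nonneg_right (hf y).2 (hnn y)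
  have sqg : ∀ y, gen K f y ^ 2 ≤ (2 * C) * fish K f y := fun y => by
    linarith [sq_gen_le K bf y, leG y]
  -- Every part of the remainder is bounded by Γ(f)/f at x and its average over K. A remainder that
  -- were merely O(ε²) could not be absorbed into a contraction rate.
  have hGg : Gam K (gen K f) (gen K f) x ≤
      2 * C * (expect (K x) (fish K f) + fish K f x) := by
    have := expect_mono (K x) bg.sq (bh.const_mul (2 * C)) sqg
    rw [expect_const_mul] at this
    linarith [Gam_self_le K bg x, sqg x]
  have hq : (gen K f x / f x) ^ 2 ≤ (C / c) ^ 2 := by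
    rw [sq_le_sq, abs_div, abs_of_pos (div_pos hC hc), abs_of_pos (pos x)]
    refine div_le_div₀ hC.le ?_ hc (hf x).1
    have hl := le_expect (K x) bf fun y => (hf y).1
    have hu := expect_le (K x) bf fun y => (hf y).2
    rw [gen_eq K bf, abs_le]
    constructor <;> linarith [(hf x).1, (hf x).2]
  have hR : (Gam K (gen K f) (gen K f) x - 2 * (gen K f x / f x) * Gam K f (gen K f) x
        + (gen K f x / f x) ^ 2 * Gam K f f x) / euler K ε f x ≤
      2 * (2 * C + (C / c) ^ 2 * C) / c * (expect (K x) (fish K f) + fish K f x) := by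
    rw [div_le_iff₀ (hc.trans_le he.1)]
    have a1 := two_mul_Gam_le (K := K) bf bg (gen K f x / f x) x
    have a2 : (gen K f x / f x) ^ 2 * Gam K f f x ≤
        (C / c) ^ 2 * (C * (expect (K x) (fish K f) + fish K f x)) :=
      mul_le_mul hq ((leG x).trans (mul_le_mul_of_nonneg_left (by linarith) hC.le))
        (Gam_self_nonneg K f x) (sq_nonneg _)
    have a3 : 2 * (2 * C + (C / c) ^ 2 * C) / c * (expect (K x) (fish K f) + fish K f x) * c ≤
        2 * (2 * C + (C / c) ^ 2 * C) / c * (expect (K x) (fish K f) + fish K f x)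
          * euler K ε f x :=
      mul_le_mul_of_nonneg_left he.1 (mul_nonneg (by positivity) (add_nonneg hP (hnn x)))
    have a4 : 2 * (2 * C + (C / c) ^ 2 * C) / c * (expect (K x) (fish K f) + fish K f x) * c =
        2 * (2 * C + (C / c) ^ 2 * C) * (expect (K x) (fish K f) + fish K f x) := by
      field_simp
    nlinarith
  rw [fish_euler_eq bf (pos x).ne' (hc.trans_le he.1).ne']
  have b1 := mul_le_mul_of_nonneg_left (h.le_gen_fish hc hf x) h0
  have b2 := mul_le_mul_of_nonneg_left hR (sq_nonneg ε)
  linarith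

/-- For small steps the Euler scheme contracts `Γ(f)/f`, in mean and in supremum, at a rate
as close to the curvature as desired. -/
theorem CDEPrime.exists_contraction {κ κ' : ℝ} (h : CDEPrime K κ) {π : PMF X}
    (hrev : Reversible K π) (hκ' : 0 < κ') (hlt : κ' < κ) (hc : 0 < c) (hcC : c ≤ C) :
    ∃ ε₀ > 0, ∀ ε, 0 < ε → ε < ε₀ → ε < 1 ∧ κ' * ε < 1 ∧ ∀ f : X → ℝ, Between c C f →
      expect π (fish K (euler K ε f)) ≤ (1 - κ' * ε) ^ 2 * expect π (fish K f) ∧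
      ∀ H, (∀ x, fish K f x ≤ H) → ∀ x, fish K (euler K ε f) x ≤ (1 - κ' * ε) ^ 2 * H := by
  set M := 2 * (2 * C + (C / c) ^ 2 * C) / c with hM
  have hC : 0 < C := hc.trans_le hcC
  have hM0 : 0 < M := by positivity
  have hκ : 0 < κ := hκ'.trans hlt
  -- The first bound keeps the coefficient 1 - ε(1+2κ) of Γ(f)/f positive, as the supremum estimate
  -- needs; the second makes the remainder smaller than the gap between κ and κ'. Both depend on f
  -- only through c and C, so one ε serves all iterates.
  refine ⟨min (1 / (1 + 2 * κ)) ((κ - κ') / M), lt_min (by positivity)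
    (div_pos (sub_pos.2 hlt) hM0), fun ε h0 hε => ?_⟩
  have e1 : ε * (1 + 2 * κ) < 1 := (lt_div_iff₀ (by positivity)).1 (hε.trans_le (min_le_left _ _))
  have e2 : ε * M < κ - κ' := (lt_div_iff₀ hM0).1 (hε.trans_le (min_le_right _ _))
  have e3 : 0 < ε * κ := mul_pos h0 hκ
  have hε1 : ε < 1 := by nlinarith
  have rate : 1 - 2 * κ * ε + 2 * M * ε ^ 2 ≤ (1 - κ' * ε) ^ 2 := by
    nlinarith [sq_nonneg (κ' * ε)]
  refine ⟨hε1, by nlinarith, fun f hf => ?_⟩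
  have bh : Bounded (fish K f) := hf.bounded_fish hc
  have hnn : ∀ y, 0 ≤ fish K f y := hf.fish_nonneg hc
  have step := fun x => h.fish_euler_le hc hf h0.le hε1.le x
  rw [← hM] at step
  constructor
  · have e : ∀ x, fish K f x + ε * (expect (K x) (fish K f) - fish K f x - 2 * κ * fish K f x) +
        ε ^ 2 * (M * (expect (K x) (fish K f) + fish K f x)) =
        (1 - ε - 2 * κ * ε + ε ^ 2 * M) * fish K f x +
          (ε + ε ^ 2 * M) * expect (K x) (fish K f) := fun x => by ring
    simp only [e] at step
    have bP := bh.expect K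
    have := expect_mono π ((hf.euler_step h0.le hε1.le).bounded_fish hc)
      ((bh.const_mul _).add (bP.const_mul _)) step
    rw [expect_add _ (bh.const_mul _) (bP.const_mul _), expect_const_mul, expect_const_mul,
      hrev.expect_expect bh] at this
    have := mul_le_mul_of_nonneg_right rate (expect_nonneg π hnn)
    linarith
  · intro H hH x
    have hP : expect (K x) (fish K f) ≤ H := expect_le _ bh hH
    have hH0 : 0 ≤ H := (hnn x).trans (hH x)
    have s := step x
    have s1 : (1 - ε * (1 + 2 * κ)) * fish K f x ≤ (1 - ε * (1 + 2 * κ)) * H :=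
      mul_le_mul_of_nonneg_left (hH x) (by linarith)
    have s2 : ε * expect (K x) (fish K f) ≤ ε * H := mul_le_mul_of_nonneg_left hP h0.le
    have s3 : ε ^ 2 * M * (expect (K x) (fish K f) + fish K f x) ≤ ε ^ 2 * M * (H + H) :=
      mul_le_mul_of_nonneg_left (add_le_add hP (hH x)) (by positivity)
    have := mul_le_mul_of_nonneg_right rate hH0
    linarith

end step

/-! ### Oscillation bound and finite diameter -/

variable {K : X → PMF X}

theorem Between.iterate_euler {f : X → ℝ} {c C : ℝ} (hf : Between c C f) {ε : ℝ} (h0 : 0 ≤ ε)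
    (h1 : ε ≤ 1) (n : ℕ) : Between c C ((euler K ε)^[n] f) := by
  induction n with
  | zero => exact hf
  | succ n ih =>
    rw [Function.iterate_succ_apply']
    exact ih.euler_step h0 h1

theorem Irreducible.tendsto_sub_zero (hirr : Irreducible K) {u : ℕ → X → ℝ}
    (h : ∀ x y, 0 < K x y → Filter.Tendsto (fun n => u n y - u n x) Filter.atTop (nhds 0))
    (x y : X) : Filter.Tendsto (fun n => u n y - u n x) Filter.atTop (nhds 0) := by
  induction hirr x y with
  | refl => simp
  | tail _ hbc ih => simpa using ih.add (h _ _ hbc)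

/-- Under the curvature condition the supremum of `Γ(f)/f` controls the oscillation of `f`. -/
theorem CDEPrime.osc_le {κ κ' c C H : ℝ} (h : CDEPrime K κ) {π : PMF X}
    (hrev : Reversible K π) (hirr : Irreducible K) (hκ' : 0 < κ') (hlt : κ' < κ) (hc : 0 < c)
    (hcC : c ≤ C) {f : X → ℝ} (hf : Between c C f) (hH : ∀ x, fish K f x ≤ H) (x y : X) :
    |f y - f x| ≤ 2 * (√(2 * C * H) / κ') := by
  obtain ⟨ε₀, hε₀, hε⟩ := h.exists_contraction hrev hκ' hlt hc hcC
  obtain ⟨h1, hr, hstep⟩ := hε (ε₀ / 2) (by linarith) (by linarith)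
  set ε := ε₀ / 2
  have h0 : 0 < ε := by simp only [ε]; linarith
  have hC : 0 < C := hc.trans_le hcC
  have hH0 : 0 ≤ H := (hf.fish_nonneg hc x).trans (hH x)
  set r := 1 - κ' * ε with hrdef
  have hr0 : 0 < r := by linarith
  have hr1 : r < 1 := by linarith [mul_pos hκ' h0]
  set u : ℕ → X → ℝ := fun n => (euler K ε)^[n] f with hu
  have ub : ∀ n, Between c C (u n) := hf.iterate_euler h0.le h1.le
  have usucc : ∀ n, u (n + 1) = euler K ε (u n) := fun n => Function.iterate_succ_apply' _ _ _
  have uH : ∀ n x, fish K (u n) x ≤ (r ^ n) ^ 2 * H := by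
    intro n
    induction n with
    | zero => simpa [hu] using hH
    | succ n ih =>
      intro x
      have := (hstep (u n) (ub n)).2 _ ih x
      rw [usucc]
      convert this using 1
      ring
  have hG : ∀ n x, 2 * Gam K (u n) (u n) x ≤ (r ^ n) ^ 2 * (2 * C * H) := by
    intro n x
    have e : Gam K (u n) (u n) x = u n x * fish K (u n) x := by
      rw [fish, mul_div_cancel₀ _ (hc.trans_le (ub n x).1).ne']
    have := mul_le_mul (ub n x).2 (uH n x) ((ub n).fish_nonneg hc x) hC.le
    rw [e]
    linarith
  have hdiff : ∀ n x, |u (n + 1) x - u n x| ≤ ε * (r ^ n * √(2 * C * H)) := by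
    intro n x
    have e : u (n + 1) x - u n x = ε * gen K (u n) x := by rw [usucc, euler]; ring
    rw [e, abs_mul, abs_of_pos h0]
    refine mul_le_mul_of_nonneg_left (abs_le_of_sq_le_sq ?_ (by positivity)) h0.le
    rw [mul_pow, Real.sq_sqrt (by positivity)]
    exact (sq_gen_le K (ub n).bounded x).trans (hG n x)
  -- The displacements form a geometric series: ε r^n = (r^n - r^(n+1))/κ' because r = 1 - κ'ε.
  have hsum : ∀ n x, |u n x - f x| ≤ (1 - r ^ n) * (√(2 * C * H) / κ') := by
    intro n x
    induction n with
    | zero => simp [hu]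
    | succ n ih =>
      have e : ε * (r ^ n * √(2 * C * H)) = (r ^ n - r ^ (n + 1)) * (√(2 * C * H) / κ') := by
        rw [pow_succ, hrdef]
        field_simp
        ring
      calc |u (n + 1) x - f x| ≤ |u (n + 1) x - u n x| + |u n x - f x| := _root_.abs_sub_le _ _ _
        _ ≤ _ := add_le_add (hdiff n x) ih
        _ = _ := by rw [e]; ring
  -- One edge contributes K(a,b)(u(b)-u(a))² to 2Γ(u)(a), which tends to 0. Irreducibility passes
  -- this from edges to arbitrary pairs, so the iterates flatten pointwise.
  have hlim := hirr.tendsto_sub_zero (u := u) (fun a b hab => by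
    have hk : 0 < (K a b).toReal := ENNReal.toReal_pos hab.ne' ((K a).apply_ne_top b)
    have hle : ∀ n, |u n b - u n a| ≤ r ^ n * √(2 * C * H / (K a b).toReal) := fun n => by
      refine abs_le_of_sq_le_sq ?_ (by positivity)
      rw [mul_pow, Real.sq_sqrt (by positivity), ← mul_div_assoc, le_div_iff₀ hk]
      have bd := (ub n).bounded.sub (.const (u n a))
      have := mul_toReal_le_expect (K a) (bd.mul bd) (fun y => mul_self_nonneg _) b
      have hg := hG n a
      rw [Gam_eq_expect] at hg
      linarith
    refine squeeze_zero_norm hle ?_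
    simpa using (tendsto_pow_atTop_nhds_zero_of_lt_one hr0.le hr1).mul_const
      (√(2 * C * H / (K a b).toReal))) x y
  have hfin : ∀ n, |f y - f x| ≤ |u n y - u n x| + 2 * (√(2 * C * H) / κ') := by
    intro n
    have a1 := hsum n x
    have a2 := hsum n y
    have a3 : (1 - r ^ n) * (√(2 * C * H) / κ') ≤ √(2 * C * H) / κ' :=
      mul_le_of_le_one_left (by positivity) (by linarith [pow_pos hr0 n])
    have e : f y - f x = (u n y - u n x) + ((u n x - f x) - (u n y - f y)) := by ring
    rw [e]
    refine (abs_add_le _ _).trans (add_le_add le_rfl ((abs_sub _ _).trans ?_))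
    linarith
  refine ge_of_tendsto' (x := Filter.atTop) (f := fun n => |u n y - u n x| + _) ?_ hfin
  simpa using hlim.abs.add_const (2 * (√(2 * C * H) / κ'))

section graph

theorem graph_adj {x y : X} (hne : x ≠ y) (h : 0 < K x y) : (graph K).Adj x y :=
  (SimpleGraph.fromRel_adj _ _ _).2 ⟨hne, Or.inl h⟩

theorem graph_dist_le_one {x y : X} (h : 0 < K x y) : (graph K).dist x y ≤ 1 := by
  by_cases hne : x = y
  · simp [hne]
  · exact (SimpleGraph.dist_eq_one_iff_adj.2 (graph_adj hne h)).le

theorem Irreducible.connected [Nonempty X] (hirr : Irreducible K) : (graph K).Connected := by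
  refine ⟨fun x y => ?_⟩
  induction hirr x y with
  | refl => rfl
  | @tail b c _ hbc ih =>
    by_cases hne : b = c
    · rwa [← hne]
    · exact ih.trans (graph_adj hne hbc).reachable

/-- Positive curvature forces finite diameter. -/
theorem CDEPrime.exists_dist_le {κ : ℝ} (h : CDEPrime K κ) {π : PMF X} (hrev : Reversible K π)
    (hirr : Irreducible K) (hκ : 0 < κ) : ∃ D : ℕ, ∀ x y, (graph K).dist x y ≤ D := by
  -- A function climbing from 1 to 2 over distance R = D has Γ(f)/f ≤ 1/(2R²). With C = 2 and κ' =
  -- κ/2 its oscillation is then at most 2√2/(κ'R), which this choice of D makes less than 1.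
  obtain ⟨D, hD⟩ : ∃ D : ℕ, _ < (D : ℝ) := exists_nat_gt (2 * (√2 / (κ / 2)))
  refine ⟨D, fun x y => ?_⟩
  have : Nonempty X := ⟨x⟩
  have hconn := hirr.connected
  by_contra! hlt
  have hDpos : (0 : ℝ) < D := lt_of_le_of_lt (by positivity) hD
  obtain ⟨R, hR⟩ : ∃ R : ℝ, R = D := ⟨_, rfl⟩
  rw [← hR] at hDpos hD
  set g : X → ℝ := fun z => min ((graph K).dist x z : ℝ) R with hg
  set f : X → ℝ := fun z => 1 + g z / R with hfdef
  have hf : Between 1 2 f := fun z => by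
    have h1 : 0 ≤ g z := le_min (Nat.cast_nonneg _) hDpos.le
    have h2 : g z ≤ R := min_le_right _ _
    have h3 : g z / R ≤ 1 := (div_le_one hDpos).2 h2
    exact ⟨by simp only [hfdef]; linarith [div_nonneg h1 hDpos.le],
      by simp only [hfdef]; linarith⟩
  have hlip : ∀ a b, 0 < K a b → |g b - g a| ≤ 1 := fun a b hab => by
    have e := graph_dist_le_one hab
    have t1 := hconn.dist_triangle (u := x) (v := a) (w := b)
    have t2 := hconn.dist_triangle (u := x) (v := b) (w := a)
    rw [SimpleGraph.dist_comm (u := b)] at t2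
    refine (abs_min_sub_min_le_max _ _ _ _).trans ?_
    rw [sub_self, abs_zero, max_le_iff, abs_le]
    have t1' : ((graph K).dist x b : ℝ) ≤ (graph K).dist x a + 1 := by exact_mod_cast (by omega)
    have t2' : ((graph K).dist x a : ℝ) ≤ (graph K).dist x b + 1 := by exact_mod_cast (by omega)
    exact ⟨⟨by linarith, by linarith⟩, zero_le_one⟩
  have hH : ∀ a, fish K f a ≤ 1 / 2 / R ^ 2 := fun a => by
    have b := hf.bounded.sub (.const (f a))
    have hE : expect (K a) (fun y => (f y - f a) * (f y - f a)) ≤ 1 / R ^ 2 := by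
      have : expect (K a) (fun y => (f y - f a) * (f y - f a)) ≤
          expect (K a) (fun _ => 1 / R ^ 2) := by
        refine ((b.mul b).summable _).tsum_le_tsum (fun z => ?_)
          ((Bounded.const _).summable _)
        by_cases hz : K a z = 0
        · simp [hz]
        · refine mul_le_mul_of_nonneg_right ?_ ENNReal.toReal_nonneg
          have e : f z - f a = (g z - g a) / R := by simp only [hfdef]; ring
          change (f z - f a) * (f z - f a) ≤ 1 / R ^ 2
          rw [e, ← pow_two, div_pow]
          refine div_le_div_of_nonneg_right ?_ (by positivity)
          exact (sq_le_one_iff_abs_le_one _).2 (hlip a z (pos_iff_ne_zero.2 hz))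
      rwa [expect_const] at this
    have hG : Gam K f f a ≤ 1 / 2 / R ^ 2 := by
      rw [Gam_eq_expect]
      calc _ ≤ 1 / 2 * (1 / R ^ 2) := by linarith
        _ = _ := by ring
    exact (div_le_self (Gam_self_nonneg K f a) (hf a).1).trans hG
  have key := h.osc_le hrev hirr (half_pos hκ) (half_lt_self hκ) one_pos one_le_two hf hH x y
  have e1 : f y - f x = 1 := by
    have : R < ((graph K).dist x y : ℝ) := by rw [hR]; exact_mod_cast hlt
    have g1 : g y = R := min_eq_right this.le
    have g2 : g x = 0 := by simp [hg, hDpos.le]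
    simp only [hfdef, g1, g2]
    rw [div_self hDpos.ne']; ring
  have e2 : √(2 * 2 * (1 / 2 / R ^ 2)) = √2 / R := by
    rw [show 2 * 2 * (1 / 2 / R ^ 2) = 2 / R ^ 2 by ring, Real.sqrt_div zero_le_two,
      Real.sqrt_sq hDpos.le]
  rw [e1, abs_one, e2] at key
  have : 2 * (√2 / R / (κ / 2)) = 2 * (√2 / (κ / 2)) / R := by ring
  rw [this, le_div_iff₀ hDpos] at key
  linarith

end graph

/-! ### Weak transport cost: gluing, flows, bounded cost -/

section weighted

open MeasureTheory

theorem tsum_mul_eq_lintegral (w f : X → ℝ≥0∞) :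
    ∑' x, w x * f x = @lintegral X ⊤ ((@Measure.count X ⊤).withDensity w) f := by
  let _ : MeasurableSpace X := ⊤
  rw [lintegral_withDensity_eq_lintegral_mul _ measurable_from_top measurable_from_top,
    lintegral_count]
  rfl

/-- Minkowski's inequality in the weighted L² space. -/
theorem tsum_mul_add_sq_le (w : X → ℝ≥0∞) {f g : X → ℝ≥0∞} {a b : ℝ≥0∞}
    (hf : ∑' x, w x * f x ^ 2 ≤ a ^ 2) (hg : ∑' x, w x * g x ^ 2 ≤ b ^ 2) :
    ∑' x, w x * (f x + g x) ^ 2 ≤ (a + b) ^ 2 := by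
  let _ : MeasurableSpace X := ⊤
  rw [tsum_mul_eq_lintegral] at hf hg ⊢
  have h := ENNReal.lintegral_Lp_add_le (μ := (@Measure.count X ⊤).withDensity w) (p := 2)
    (f := f) (g := g) measurable_from_top.aemeasurable measurable_from_top.aemeasurable one_le_two
  simp only [ENNReal.rpow_two, Pi.add_apply] at h
  have root : ∀ {s t : ℝ≥0∞}, s ≤ t ^ 2 → s ^ (1 / 2 : ℝ) ≤ t := fun {s t} hs => by
    rwa [one_div, ENNReal.rpow_inv_le_iff (by norm_num), ENNReal.rpow_two]
  have h2 := h.trans (add_le_add (root hf) (root hg))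
  rw [one_div, ENNReal.rpow_inv_le_iff (by norm_num), ENNReal.rpow_two] at h2
  exact h2

/-- Jensen's inequality, as Hölder against the constant 1. -/
theorem sq_tsum_pmf_mul_le (p : PMF X) (f : X → ℝ≥0∞) :
    (∑' x, p x * f x) ^ 2 ≤ ∑' x, p x * f x ^ 2 := by
  let _ : MeasurableSpace X := ⊤
  have h1 : ∑' x, p x * (1 : X → ℝ≥0∞) x ^ 2 = 1 := by simp
  rw [tsum_mul_eq_lintegral] at h1
  rw [tsum_mul_eq_lintegral, tsum_mul_eq_lintegral]
  have h := ENNReal.lintegral_mul_le_Lp_mul_Lq ((@Measure.count X ⊤).withDensity p)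
    Real.HolderConjugate.two_two (f := f) (g := 1) measurable_from_top.aemeasurable
    measurable_from_top.aemeasurable
  simp only [ENNReal.rpow_two, mul_one, h1, ENNReal.one_rpow] at h
  rw [one_div, ENNReal.le_rpow_inv_iff (by norm_num), ENNReal.rpow_two] at h
  exact h

end weighted

/-- There is a coupling from `μ` to `ν` of weak transport cost at most `c²`. -/
def Link (d : X → X → ℝ≥0∞) (c : ℝ≥0∞) (μ ν : PMF X) : Prop :=
  ∃ p : X → PMF X, μ.bind p = ν ∧ ∑' x, μ x * (∑' y, d x y * p x y) ^ 2 ≤ c ^ 2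

section Link

variable {d : X → X → ℝ≥0∞} {μ ν ρ : PMF X} {a b c : ℝ≥0∞}

theorem Link.weakCost_le (h : Link d c μ ν) : weakCost d ν μ ≤ c ^ 2 := by
  obtain ⟨p, hp, hc⟩ := h
  exact (iInf₂_le p hp).trans hc

theorem Link.mono (h : Link d a μ ν) (hab : a ≤ b) : Link d b μ ν := by
  obtain ⟨p, hp, hc⟩ := h
  exact ⟨p, hp, hc.trans (pow_le_pow_left' hab 2)⟩

theorem Link.refl (hd : ∀ x, d x x = 0) (μ : PMF X) : Link d 0 μ μ := by
  refine ⟨PMF.pure, μ.bind_pure, ?_⟩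
  have : ∀ x, ∑' y, d x y * PMF.pure x y = 0 := fun x => ENNReal.tsum_eq_zero.2 fun y => by
    by_cases h : y = x
    · simp [h, hd]
    · simp [PMF.pure_apply, h]
  simp only [this]
  simp

/-- Compose the kernels. The mean displacement from x is at most that of p plus the p-average of
that of q; Jensen bounds the L²(μ) norm of the latter by an L²(ν) norm, and Minkowski adds the two.
-/
theorem Link.trans (hd : ∀ x y z, d x z ≤ d x y + d y z) (h₁ : Link d a μ ν)
    (h₂ : Link d b ν ρ) : Link d (a + b) μ ρ := by
  obtain ⟨p, hp, ha⟩ := h₁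
  obtain ⟨q, hq, hb⟩ := h₂
  refine ⟨fun x => (p x).bind q, by rw [← PMF.bind_bind, hp, hq], ?_⟩
  have h1 : ∀ x, ∑' z, d x z * ((p x).bind q) z ≤
      ∑' y, d x y * p x y + ∑' y, p x y * ∑' z, d y z * q y z := fun x => by
    calc ∑' z, d x z * ((p x).bind q) z
        = ∑' y, ∑' z, d x z * (p x y * q y z) := by
          simp only [PMF.bind_apply, ← ENNReal.tsum_mul_left]
          exact ENNReal.tsum_comm
      _ ≤ ∑' y, ∑' z, (d x y * p x y * q y z + p x y * (d y z * q y z)) := by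
          refine ENNReal.tsum_le_tsum fun y => ENNReal.tsum_le_tsum fun z => ?_
          calc d x z * (p x y * q y z) ≤ (d x y + d y z) * (p x y * q y z) :=
                mul_le_mul_left (hd x y z) _
            _ = _ := by ring
      _ = _ := by
          simp only [ENNReal.tsum_add, ENNReal.tsum_mul_left, PMF.tsum_coe, mul_one]
  have h2 : ∑' x, μ x * (∑' y, p x y * ∑' z, d y z * q y z) ^ 2 ≤ b ^ 2 := by
    refine le_trans ?_ hb
    calc _ ≤ ∑' x, μ x * ∑' y, p x y * (∑' z, d y z * q y z) ^ 2 :=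
          ENNReal.tsum_le_tsum fun x => mul_le_mul_right (sq_tsum_pmf_mul_le _ _) _
      _ = ∑' y, ν y * (∑' z, d y z * q y z) ^ 2 := by
          simp only [← hp, PMF.bind_apply, ← ENNReal.tsum_mul_left, ← ENNReal.tsum_mul_right]
          rw [ENNReal.tsum_comm]
          exact tsum_congr fun x => tsum_congr fun y => by ring
  exact (ENNReal.tsum_le_tsum fun x => mul_le_mul_right (pow_le_pow_left' (h1 x) 2) _).trans
    (tsum_mul_add_sq_le _ ha h2)

/-- A coupling which moves the mass `F x y` from `x` to `y` and leaves the rest in place. -/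
theorem Link.of_flow (hd : ∀ x, d x x = 0) (F : X → X → ℝ≥0∞) (hF : ∀ x, ∑' y, F x y ≤ μ x)
    (hbal : ∀ y, ν y + ∑' z, F y z = μ y + ∑' x, F x y)
    (hc : ∑' x, (∑' y, d x y * F x y) ^ 2 / μ x ≤ c ^ 2) : Link d c μ ν := by
  classical
  have hle : ∀ x, ∑' y, F x y / μ x ≤ 1 := fun x => by
    simp only [div_eq_mul_inv, ENNReal.tsum_mul_right]
    exact ENNReal.div_le_of_le_mul (by simpa using hF x)
  have hμF : ∀ x y, μ x * (F x y / μ x) = F x y := fun x y => by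
    by_cases h : μ x = 0
    · have : F x y = 0 := le_zero_iff.1 (((ENNReal.le_tsum y).trans (hF x)).trans h.le)
      simp [h, this]
    · exact ENNReal.mul_div_cancel h (μ.apply_ne_top x)
  -- Where μ x = 0 the flow out of x vanishes too, 0/0 = 0, and the row is the Dirac mass at x.
  let g : X → X → ℝ≥0∞ := fun x y =>
    F x y / μ x + if y = x then 1 - ∑' z, F x z / μ x else 0
  have hg : ∀ x, HasSum (g x) 1 := fun x => by
    refine (ENNReal.summable.hasSum_iff).2 ?_
    rw [ENNReal.tsum_add, tsum_ite_eq]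
    exact add_tsub_cancel_of_le (hle x)
  refine ⟨fun x => (⟨g x, hg x⟩ : PMF X), ?_, le_trans (ENNReal.tsum_le_tsum fun x => ?_) hc⟩
  · ext y
    refine (PMF.bind_apply _ _ _).trans ?_
    change ∑' x, μ x * (F x y / μ x + if y = x then 1 - ∑' z, F x z / μ x else 0) = ν y
    have hS : ∑' z, F y z ≠ ∞ := ((hF y).trans_lt (μ.apply_lt_top y)).ne
    have e : ∑' x, μ x * (F x y / μ x + if y = x then 1 - ∑' z, F x z / μ x else 0) =
        ∑' x, F x y + (μ y - ∑' z, F y z) := by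
      simp only [mul_add, hμF, ENNReal.tsum_add, mul_ite, mul_zero, eq_comm (a := y), tsum_ite_eq]
      rw [ENNReal.mul_sub (fun _ _ => μ.apply_ne_top y), ← ENNReal.tsum_mul_left, mul_one]
      simp only [hμF]
    rw [e, ← ENNReal.add_left_inj hS, hbal y, add_assoc, tsub_add_cancel_of_le (hF y), add_comm]
  · change μ x * (∑' y, d x y * (F x y / μ x + if y = x then 1 - ∑' z, F x z / μ x else 0)) ^ 2 ≤ _
    have e : ∑' y, d x y * (F x y / μ x + if y = x then 1 - ∑' z, F x z / μ x else 0) =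
        (∑' y, d x y * F x y) / μ x := by
      rw [div_eq_mul_inv, ← ENNReal.tsum_mul_right]
      refine tsum_congr fun y => ?_
      by_cases h : y = x
      · simp [h, hd]
      · simp [h, div_eq_mul_inv, mul_assoc]
    rw [e]
    by_cases h : μ x = 0
    · simp [h]
    · rw [pow_two, ← mul_assoc, ENNReal.mul_div_cancel h (μ.apply_ne_top x), ← mul_div_assoc,
        pow_two]

/-- Transport along the excess `μ - ν` when the cost is bounded. -/
theorem Link.of_tsub {D : ℝ≥0∞} (hd : ∀ x, d x x = 0) (hD : ∀ x y, d x y ≤ D)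
    (hc : D ^ 2 * ∑' x, (μ x - ν x) ≤ c ^ 2) : Link d c μ ν := by
  set m := ∑' x, (μ x - ν x) with hm
  have hm_top : m ≠ ∞ := ((ENNReal.tsum_le_tsum fun x => tsub_le_self).trans_lt
    (by rw [μ.tsum_coe]; exact ENNReal.one_lt_top)).ne
  have hm' : ∑' x, (ν x - μ x) = m := by
    have e : ∀ x, μ x + (ν x - μ x) = ν x + (μ x - ν x) := fun x => by
      rw [add_tsub_eq_max, add_tsub_eq_max, max_comm]
    have h : ∑' x, (μ x + (ν x - μ x)) = ∑' x, (ν x + (μ x - ν x)) := tsum_congr e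
    rw [ENNReal.tsum_add, ENNReal.tsum_add, μ.tsum_coe, ν.tsum_coe] at h
    exact (ENNReal.add_right_inj ENNReal.one_ne_top).1 h
  by_cases h0 : m = 0
  · have h1 : ∀ x, μ x ≤ ν x := fun x => tsub_eq_zero_iff_le.1 (ENNReal.tsum_eq_zero.1 h0 x)
    have h2 : ∀ x, ν x ≤ μ x := fun x =>
      tsub_eq_zero_iff_le.1 (ENNReal.tsum_eq_zero.1 (hm'.trans h0) x)
    have : μ = ν := PMF.ext fun x => le_antisymm (h1 x) (h2 x)
    rw [← this]
    exact (Link.refl hd μ).mono zero_le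
  have out : ∀ x, ∑' y, (μ x - ν x) * (ν y - μ y) / m = μ x - ν x := fun x => by
    simp only [div_eq_mul_inv, ENNReal.tsum_mul_left, ENNReal.tsum_mul_right, hm']
    rw [mul_assoc, ENNReal.mul_inv_cancel h0 hm_top, mul_one]
  -- The excess of μ is spread over the deficit in proportion (an independent coupling), so the row
  -- sums are μ - ν and the column sums ν - μ, both truncated at 0.
  refine Link.of_flow hd (fun x y => (μ x - ν x) * (ν y - μ y) / m)
    (fun x => (out x).le.trans tsub_le_self) (fun y => ?_) (le_trans ?_ hc)
  · simp only [out]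
    have : ∑' x, (μ x - ν x) * (ν y - μ y) / m = ν y - μ y := by
      simp only [div_eq_mul_inv, ENNReal.tsum_mul_right, ← hm]
      rw [mul_comm m, mul_assoc, ENNReal.mul_inv_cancel h0 hm_top, mul_one]
    rw [this, add_tsub_eq_max, add_tsub_eq_max, max_comm]
  · rw [hm, ← ENNReal.tsum_mul_left]
    refine ENNReal.tsum_le_tsum fun x => ?_
    have h1 : ∑' y, d x y * ((μ x - ν x) * (ν y - μ y) / m) ≤ D * (μ x - ν x) := by
      rw [← out x, ← ENNReal.tsum_mul_left]
      exact ENNReal.tsum_le_tsum fun y => by rw [out x]; exact mul_le_mul_left (hD x y) _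
    refine ENNReal.div_le_of_le_mul ?_
    calc _ ≤ (D * (μ x - ν x)) ^ 2 := pow_le_pow_left' h1 2
      _ = D ^ 2 * (μ x - ν x) * (μ x - ν x) := by ring
      _ ≤ _ := mul_le_mul_right tsub_le_self _

end Link

/-! ### Transport along an Euler step -/

variable {π : PMF X}

theorem Bounded.max_zero {u : X → ℝ} (hu : Bounded u) : Bounded (fun x => max (u x) 0) := by
  obtain ⟨C, hC⟩ := hu
  refine ⟨C, fun x => ?_⟩
  rw [abs_of_nonneg (le_max_right _ _)]
  exact max_le ((le_abs_self _).trans (hC x)) ((abs_nonneg _).trans (hC x))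

theorem toReal_apply_le_one (p : PMF X) (x : X) : (p x).toReal ≤ 1 :=
  ENNReal.toReal_le_of_le_ofReal zero_le_one (by simpa using p.coe_le_one x)

theorem le_jumpRate (K : X → PMF X) (x : X) : 1 - (K x x).toReal ≤ jumpRate K :=
  le_ciSup (f := fun x => 1 - (K x x).toReal)
    ⟨1, by rintro _ ⟨y, rfl⟩; simp⟩ x

theorem jumpRate_nonneg (K : X → PMF X) : 0 ≤ jumpRate K :=
  Real.iSup_nonneg fun _ => sub_nonneg.2 (toReal_apply_le_one _ _)

/-- Since v vanishes at x, Cauchy-Schwarz against the indicator of y ≠ x gains its mean 1 - K(x,x) ≤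
J. This is where J enters the constant. -/
theorem sq_expect_le_jumpRate {f v : X → ℝ} (hf : Bounded f) (hv : Bounded v) {x : X}
    (hvx : v x = 0) {ε : ℝ} (hle : ∀ y, v y ^ 2 ≤ ε ^ 2 * (f y - f x) ^ 2) :
    expect (K x) v ^ 2 ≤ jumpRate K * (ε ^ 2 * (2 * Gam K f f x)) := by
  classical
  have bi : Bounded (fun y => if y = x then (1 : ℝ) else 0) :=
    .of_mem_Icc (a := 0) (b := 1) fun y => by split_ifs <;> simp
  have bs := (Bounded.const 1).sub bi
  have e1 : v = fun y => (1 - if y = x then (1 : ℝ) else 0) * v y := by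
    ext y
    by_cases h : y = x
    · simp [h, hvx]
    · simp [h]
  have e2 : expect (K x) (fun y => (1 - if y = x then (1 : ℝ) else 0) ^ 2) ≤ jumpRate K := by
    have : (fun y => (1 - if y = x then (1 : ℝ) else 0) ^ 2) =
        fun y => 1 - if y = x then (1 : ℝ) else 0 := by
      ext y; split_ifs <;> norm_num
    rw [this, expect_sub _ (.const 1) bi, expect_const]
    refine le_trans (le_of_eq ?_) (le_jumpRate K x)
    simp [expect]
  have e3 : expect (K x) (fun y => v y ^ 2) ≤ ε ^ 2 * (2 * Gam K f f x) := by
    have b := hf.sub (.const (f x))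
    have := expect_mono (K x) hv.sq (b.sq.const_mul (ε ^ 2)) hle
    rw [expect_const_mul] at this
    simp only [Gam_eq_expect, ← pow_two]
    linarith
  have h := sq_expect_mul_le (K x) bs hv
  rw [← e1] at h
  exact h.trans (mul_le_mul e2 e3 (expect_nonneg _ fun y => sq_nonneg _) (jumpRate_nonneg K))

/-- `μ` has density `f` with respect to `π`. -/
def HasDensity (π : PMF X) (f : X → ℝ) (μ : PMF X) : Prop :=
  ∀ x, μ x = ENNReal.ofReal (f x) * π x

theorem exists_hasDensity {f : X → ℝ} (hf : Bounded f) (h0 : ∀ x, 0 ≤ f x)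
    (h1 : expect π f = 1) : ∃ μ : PMF X, HasDensity π f μ := by
  have h := ofReal_expect π hf h0
  rw [h1, ENNReal.ofReal_one] at h
  exact ⟨⟨_, ENNReal.summable.hasSum_iff.2 h.symm⟩, fun x => rfl⟩

section flow

variable {d : X → X → ℝ≥0∞} {f : X → ℝ} {c C ε : ℝ} {μ ν : PMF X}

theorem sq_tsum_flow_div_le (hd : ∀ x y, 0 < K x y → d x y ≤ 1) {w : X → X → ℝ} {x : X} {s t : ℝ}
    (hs0 : 0 ≤ s) (ht : 0 < t)
    (hs : ∑' y, K x y * ENNReal.ofReal (w x y) = ENNReal.ofReal s) :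
    (∑' y, d x y * (π x * (K x y * ENNReal.ofReal (w x y)))) ^ 2 / (ENNReal.ofReal t * π x) ≤
      ENNReal.ofReal (s ^ 2 / t) * π x := by
  have h1 : ∑' y, d x y * (π x * (K x y * ENNReal.ofReal (w x y))) ≤ π x * ENNReal.ofReal s := by
    rw [← hs, ← ENNReal.tsum_mul_left]
    refine ENNReal.tsum_le_tsum fun y => ?_
    by_cases h : K x y = 0
    · simp [h]
    · exact mul_le_of_le_one_left' (hd x y (pos_iff_ne_zero.2 h))
  refine ENNReal.div_le_of_le_mul ((pow_le_pow_left' h1 2).trans (le_of_eq ?_))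
  have h2 : ENNReal.ofReal (s ^ 2 / t) * ENNReal.ofReal t = ENNReal.ofReal s ^ 2 := by
    rw [← ENNReal.ofReal_mul (by positivity), div_mul_cancel₀ _ ht.ne', ENNReal.ofReal_pow hs0]
  calc _ = ENNReal.ofReal s ^ 2 * π x * π x := by ring
    _ = _ := by rw [← h2]; ring

/-- The coupling along one Euler step, in both directions. -/
theorem Reversible.link_euler (hrev : Reversible K π) (hdiag : ∀ x, d x x = 0)
    (hd : ∀ x y, 0 < K x y → d x y ≤ 1) (hc : 0 < c) (hf : Between c C f) (h0 : 0 ≤ ε)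
    (h1 : ε < 1) (hμ : HasDensity π f μ) (hν : HasDensity π (euler K ε f) ν) :
    Link d (ENNReal.ofReal (ε * (√(2 * jumpRate K * expect π (fish K f)) / (1 - ε)))) μ ν ∧
    Link d (ENNReal.ofReal (ε * (√(2 * jumpRate K * expect π (fish K f)) / (1 - ε)))) ν μ := by
  have bf := hf.bounded
  have pos : ∀ x, 0 < f x := fun x => hc.trans_le (hf x).1
  have hJ := jumpRate_nonneg K
  have bfish : Bounded (fish K f) := hf.bounded_fish hc
  have nnfish : ∀ x, 0 ≤ fish K f x := hf.fish_nonneg hc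
  have hI : 0 ≤ expect π (fish K f) := expect_nonneg _ nnfish
  have h1' : 0 < 1 - ε := sub_pos.2 h1
  set a : X → ℝ := fun x => expect (K x) (fun y => max (ε * (f x - f y)) 0) with ha
  set b : X → ℝ := fun x => expect (K x) (fun y => max (ε * (f y - f x)) 0) with hb
  have ba : ∀ x, Bounded (fun y => ε * (f x - f y)) := fun x =>
    ((Bounded.const (f x)).sub bf).const_mul ε
  have bb : ∀ x, Bounded (fun y => ε * (f y - f x)) := fun x => (bf.sub (.const (f x))).const_mul ε
  have ha0 : ∀ x, 0 ≤ a x := fun x => expect_nonneg _ fun y => le_max_right _ _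
  have hb0 : ∀ x, 0 ≤ b x := fun x => expect_nonneg _ fun y => le_max_right _ _
  have bal : ∀ x, euler K ε f x + a x = f x + b x := fun x => by
    have : b x - a x = ε * gen K f x := by
      change expect _ _ - expect _ _ = ε * expect (K x) (fun y => f y - f x)
      rw [← expect_sub _ (bb x).max_zero (ba x).max_zero, ← expect_const_mul]
      congr 1
      ext y
      rw [show ε * (f x - f y) = -(ε * (f y - f x)) by ring]
      exact max_zero_sub_eq_self _
    rw [euler]
    linarith
  -- Positivity of f gives (f(x)-f(y))⁺ ≤ f(x). Hence the outflow is affordable, and at least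
  -- (1-ε)f(x) remains after the step.
  have a_le : ∀ x, a x ≤ ε * f x := fun x => expect_le _ (ba x).max_zero fun y =>
    max_le (mul_le_mul_of_nonneg_left (by linarith [pos y]) h0) (mul_nonneg h0 (pos x).le)
  have le_euler : ∀ x, b x + (1 - ε) * f x ≤ euler K ε f x := fun x => by
    linarith [bal x, a_le x]
  have epos : ∀ x, 0 < euler K ε f x := fun x => by
    have := mul_pos h1' (pos x)
    linarith [le_euler x, hb0 x]
  have sq_pos_part : ∀ s t : ℝ, max (ε * (s - t)) 0 ^ 2 ≤ ε ^ 2 * (t - s) ^ 2 := fun s t => by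
    rcases max_cases (ε * (s - t)) 0 with ⟨h, -⟩ | ⟨h, -⟩ <;> rw [h]
    · exact le_of_eq (by ring)
    · rw [zero_pow two_ne_zero]; positivity
  have eG : ∀ x, Gam K f f x = fish K f x * f x := fun x =>
    (div_mul_cancel₀ _ (pos x).ne').symm
  have sqa : ∀ x, a x ^ 2 ≤ (2 * jumpRate K * ε ^ 2) * fish K f x * f x := fun x => by
    have := sq_expect_le_jumpRate (K := K) bf (ba x).max_zero (x := x) (ε := ε) (by simp)
      fun y => sq_pos_part _ _
    rw [eG] at this
    change a x ^ 2 ≤ _ at this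
    linarith
  have sqb : ∀ x, b x ^ 2 ≤ (2 * jumpRate K * ε ^ 2) * fish K f x * f x := fun x => by
    have := sq_expect_le_jumpRate (K := K) bf (bb x).max_zero (x := x) (ε := ε) (by simp)
      fun y => (sq_pos_part _ _).trans (le_of_eq (by ring))
    rw [eG] at this
    change b x ^ 2 ≤ _ at this
    linarith
  have tsum_a : ∀ x, ∑' y, K x y * ENNReal.ofReal (ε * (f x - f y)) = ENNReal.ofReal (a x) :=
    fun x => by
      rw [ha, ofReal_expect _ (ba x).max_zero fun y => le_max_right _ _]
      exact tsum_congr fun y => by rw [mul_comm, ENNReal.ofReal_max, ENNReal.ofReal_zero,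
        max_eq_left zero_le]
  have tsum_b : ∀ x, ∑' y, K x y * ENNReal.ofReal (ε * (f y - f x)) = ENNReal.ofReal (b x) :=
    fun x => by
      rw [hb, ofReal_expect _ (bb x).max_zero fun y => le_max_right _ _]
      exact tsum_congr fun y => by rw [mul_comm, ENNReal.ofReal_max, ENNReal.ofReal_zero,
        max_eq_left zero_le]
  set F : X → X → ℝ≥0∞ := fun x y => π x * (K x y * ENNReal.ofReal (ε * (f x - f y))) with hF
  -- Detailed balance: the flow into x has the form of an outflow with f(y)-f(x) in place of
  -- f(x)-f(y), so the reversed flow serves the backward coupling.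
  have hswap : ∀ x y, F y x = π x * (K x y * ENNReal.ofReal (ε * (f y - f x))) := fun x y => by
    change π y * (K y x * _) = _
    rw [← mul_assoc, ← mul_assoc, mul_comm (π y), ← hrev x y, mul_comm (π x)]
  have out : ∀ x, ∑' y, F x y = ENNReal.ofReal (a x) * π x := fun x => by
    rw [hF, ENNReal.tsum_mul_left, tsum_a, mul_comm]
  have into : ∀ x, ∑' y, F y x = ENNReal.ofReal (b x) * π x := fun x => by
    simp only [hswap x]
    rw [ENNReal.tsum_mul_left, tsum_b, mul_comm]
  have hbal : ∀ x, ν x + ∑' y, F x y = μ x + ∑' y, F y x := fun x => by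
    rw [out, into, hμ x, hν x, ← add_mul, ← add_mul, ← ENNReal.ofReal_add (epos x).le (ha0 x),
      ← ENNReal.ofReal_add (pos x).le (hb0 x), bal]
  have total : ∀ q : X → ℝ, (∀ x, q x ≤ 2 * jumpRate K * ε ^ 2 / (1 - ε) ^ 2 * fish K f x) →
      ∑' x, ENNReal.ofReal (q x) * π x ≤
        ENNReal.ofReal (ε * (√(2 * jumpRate K * expect π (fish K f)) / (1 - ε))) ^ 2 := by
    intro q hq
    rw [← ENNReal.ofReal_pow (by positivity), mul_pow, div_pow, Real.sq_sqrt (by positivity)]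
    have e : ε ^ 2 * (2 * jumpRate K * expect π (fish K f) / (1 - ε) ^ 2) =
        expect π (fun x => 2 * jumpRate K * ε ^ 2 / (1 - ε) ^ 2 * fish K f x) := by
      rw [expect_const_mul]; ring
    rw [e, ofReal_expect _ (bfish.const_mul _) fun x => mul_nonneg (by positivity) (nnfish x)]
    exact ENNReal.tsum_le_tsum fun x => mul_le_mul_left (ENNReal.ofReal_le_ofReal (hq x)) _
  have h2J : ∀ x, 0 ≤ 2 * jumpRate K * ε ^ 2 * fish K f x := fun x =>
    mul_nonneg (by positivity) (nnfish x)
  constructor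
  · refine Link.of_flow hdiag F (fun x => ?_) hbal
      ((ENNReal.tsum_le_tsum fun x => ?_).trans (total (fun x => a x ^ 2 / f x) fun x => ?_))
    · rw [out, hμ x]
      exact mul_le_mul_left (ENNReal.ofReal_le_ofReal
        ((a_le x).trans (mul_le_of_le_one_left (pos x).le h1.le))) _
    · rw [hμ x]
      exact sq_tsum_flow_div_le hd (w := fun x y => ε * (f x - f y)) (ha0 x) (pos x) (tsum_a x)
    · calc a x ^ 2 / f x ≤ 2 * jumpRate K * ε ^ 2 * fish K f x :=
            (div_le_iff₀ (pos x)).2 (sqa x)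
        _ ≤ 2 * jumpRate K * ε ^ 2 * fish K f x / (1 - ε) ^ 2 :=
            le_div_self (h2J x) (by positivity) (pow_le_one₀ h1'.le (by linarith))
        _ = _ := by ring
  · refine Link.of_flow hdiag (fun x y => F y x) (fun x => ?_) (fun x => (hbal x).symm)
      ((ENNReal.tsum_le_tsum fun x => ?_).trans
        (total (fun x => b x ^ 2 / euler K ε f x) fun x => ?_))
    · rw [into, hν x]
      exact mul_le_mul_left (ENNReal.ofReal_le_ofReal
        (by linarith [le_euler x, mul_pos h1' (pos x)])) _
    · simp only [hswap x]
      rw [hν x]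
      exact sq_tsum_flow_div_le hd (w := fun x y => ε * (f y - f x)) (hb0 x) (epos x) (tsum_b x)
    -- Backwards the source density is the new one, which is only known to exceed (1-ε)f. The square
    -- is taken so that the loss leaves the root as 1/(1-ε).
    · have hden : (1 - ε) ^ 2 * f x ≤ euler K ε f x := by
        have : (1 - ε) ^ 2 ≤ 1 - ε := by nlinarith
        have := mul_le_mul_of_nonneg_right this (pos x).le
        linarith [le_euler x, hb0 x]
      have hden0 : 0 < (1 - ε) ^ 2 * f x := mul_pos (by positivity) (pos x)
      calc b x ^ 2 / euler K ε f x ≤ b x ^ 2 / ((1 - ε) ^ 2 * f x) :=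
            div_le_div_of_nonneg_left (sq_nonneg _) hden0 hden
        _ ≤ 2 * jumpRate K * ε ^ 2 / (1 - ε) ^ 2 * fish K f x := by
            rw [div_le_iff₀ hden0]
            refine (sqb x).trans (le_of_eq ?_)
            field_simp

end flow

/-! ### The inequality for densities bounded above and below -/

theorem Reversible.expect_euler (hrev : Reversible K π) {f : X → ℝ} (hf : Bounded f) (ε : ℝ) :
    expect π (euler K ε f) = expect π f := by
  change expect π (fun x => f x + ε * gen K f x) = _
  rw [expect_add _ hf ((hf.gen K).const_mul ε), expect_const_mul, funext (gen_eq K hf),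
    expect_sub _ (hf.expect K) hf, hrev.expect_expect hf]
  ring

theorem hasDensity_one (π : PMF X) : HasDensity π (fun _ => 1) π := fun x => by simp

theorem HasDensity.tsum_tsub_le {u v : X → ℝ} {μ ν : PMF X} (hμ : HasDensity π u μ)
    (hν : HasDensity π v ν) :
    ∑' x, (μ x - ν x) ≤ ∑' x, ENNReal.ofReal |u x - v x| * π x := by
  refine ENNReal.tsum_le_tsum fun x => ?_
  rw [tsub_le_iff_right, hμ x, hν x, ← add_mul]
  refine mul_le_mul_left (le_trans (ENNReal.ofReal_le_ofReal ?_) ENNReal.ofReal_add_le) _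
  linarith [le_abs_self (u x - v x)]

theorem HasDensity.link_of_le {d : X → X → ℝ≥0∞} {D : ℕ} {u v : X → ℝ} {μ ν : PMF X} {e : ℝ}
    (hdiag : ∀ x, d x x = 0) (hD : ∀ x y, d x y ≤ D) (hμ : HasDensity π u μ)
    (hν : HasDensity π v ν) (he0 : 0 ≤ e)
    (he : ∑' x, ENNReal.ofReal |u x - v x| * π x ≤ ENNReal.ofReal e) :
    Link d (ENNReal.ofReal (D * √e)) μ ν := by
  refine Link.of_tsub hdiag hD ?_
  rw [ENNReal.ofReal_mul (Nat.cast_nonneg _), mul_pow, ENNReal.ofReal_natCast,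
    ← ENNReal.ofReal_pow (Real.sqrt_nonneg _), Real.sq_sqrt he0]
  exact mul_le_mul_right ((hμ.tsum_tsub_le hν).trans he) _

/-- The transport-information inequality for densities bounded above and below. -/
theorem CDEPrime.link_of_between {κ c C θ : ℝ} (h : CDEPrime K κ) (hrev : Reversible K π)
    (hirr : Irreducible K) (hκ : 0 < κ) {d : X → X → ℝ≥0∞} (hdiag : ∀ x, d x x = 0)
    (htri : ∀ x y z, d x z ≤ d x y + d y z) (hd : ∀ x y, 0 < K x y → d x y ≤ 1) {D : ℕ}
    (hD : ∀ x y, d x y ≤ D) (hc : 0 < c) (hcC : c ≤ C) {f : X → ℝ} (hf : Between c C f)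
    (hf1 : expect π f = 1) {μ : PMF X} (hμ : HasDensity π f μ)
    (hθ : √(2 * jumpRate K * expect π (fish K f)) / κ < θ) :
    Link d (ENNReal.ofReal θ) μ π ∧ Link d (ENNReal.ofReal θ) π μ := by
  set s := √(2 * jumpRate K * expect π (fish K f)) with hs
  have hJ := jumpRate_nonneg K
  have hs0 : 0 ≤ s := Real.sqrt_nonneg _
  -- The slack in θ is spent three times: on κ' < κ, then on the factor 1/(1-ε), and finally on
  -- stopping after n steps.
  obtain ⟨κ', hθ', hκ', hlt⟩ : ∃ κ', s / κ' < θ ∧ 0 < κ' ∧ κ' < κ := by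
    have t : Filter.Tendsto (fun k => s / k) (nhdsWithin κ (Set.Iio κ)) (nhds (s / κ)) :=
      (tendsto_const_nhds.div Filter.tendsto_id hκ.ne').mono_left nhdsWithin_le_nhds
    obtain ⟨k, h1, h2, h3⟩ := ((t.eventually_lt_const hθ).and (Ioo_mem_nhdsLT hκ)).exists
    exact ⟨k, h1, h2, h3⟩
  obtain ⟨ε₀, hε₀, hε⟩ := h.exists_contraction hrev hκ' hlt hc hcC
  obtain ⟨ε, hθε, h0, hlt₀⟩ : ∃ ε, s / κ' / (1 - ε) < θ ∧ 0 < ε ∧ ε < ε₀ := by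
    have t : Filter.Tendsto (fun ε : ℝ => s / κ' / (1 - ε)) (nhdsWithin 0 (Set.Ioi 0))
        (nhds (s / κ' / (1 - 0))) :=
      (tendsto_const_nhds.div (tendsto_const_nhds.sub Filter.tendsto_id) (by norm_num)).mono_left
        nhdsWithin_le_nhds
    rw [sub_zero, div_one] at t
    obtain ⟨k, h1, h2, h3⟩ := ((t.eventually_lt_const hθ').and (Ioo_mem_nhdsGT hε₀)).exists
    exact ⟨k, h1, h2, h3⟩
  obtain ⟨h1, hr, hstep⟩ := hε ε h0 hlt₀
  have h1' : 0 < 1 - ε := sub_pos.2 h1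
  set r := 1 - κ' * ε with hrdef
  have hr0 : 0 < r := by linarith
  have hr1 : r < 1 := by linarith [mul_pos hκ' h0]
  set u : ℕ → X → ℝ := fun n => (euler K ε)^[n] f with hu
  have ub : ∀ n, Between c C (u n) := hf.iterate_euler h0.le h1.le
  have usucc : ∀ n, u (n + 1) = euler K ε (u n) := fun n => Function.iterate_succ_apply' _ _ _
  have uone : ∀ n, expect π (u n) = 1 := by
    intro n
    induction n with
    | zero => exact hf1
    | succ n ih => rw [usucc, hrev.expect_euler (ub n).bounded, ih]
  have uI : ∀ n, expect π (fish K (u n)) ≤ (r ^ n) ^ 2 * expect π (fish K f) := by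
    intro n
    induction n with
    | zero => simp [hu]
    | succ n ih =>
      rw [usucc]
      refine ((hstep (u n) (ub n)).1.trans (mul_le_mul_of_nonneg_left ih (sq_nonneg _))).trans
        (le_of_eq ?_)
      ring
  obtain ⟨H, hH⟩ := hf.bounded_fish (K := K) hc
  have hH' : ∀ x, fish K f x ≤ H := fun x => (le_abs_self _).trans (hH x)
  have uH : ∀ n x, fish K (u n) x ≤ (r ^ n) ^ 2 * H := by
    intro n
    induction n with
    | zero => simpa [hu] using hH'
    | succ n ih =>
      intro x
      rw [usucc]
      refine ((hstep (u n) (ub n)).2 _ ih x).trans (le_of_eq ?_)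
      ring
  choose m hm using fun n => exists_hasDensity (ub n).bounded
    (fun x => hc.le.trans (ub n x).1) (uone n)
  have hm0 : m 0 = μ := PMF.ext fun x => by rw [hm 0 x, hμ x]; rfl
  -- The geometric decay of the Fisher information makes the step costs telescope, with ε r^n = (r^n
  -- - r^(n+1))/κ'.
  have cost_le : ∀ n, ε * (√(2 * jumpRate K * expect π (fish K (u n))) / (1 - ε)) ≤
      (r ^ n - r ^ (n + 1)) * (s / κ' / (1 - ε)) := fun n => by
    have a1 : √(2 * jumpRate K * expect π (fish K (u n))) ≤ r ^ n * s := by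
      rw [hs, ← Real.sqrt_sq (pow_pos hr0 n).le, ← Real.sqrt_mul (sq_nonneg _)]
      refine Real.sqrt_le_sqrt ?_
      have := mul_le_mul_of_nonneg_left (uI n) (mul_nonneg zero_le_two hJ)
      linarith
    calc _ ≤ ε * (r ^ n * s / (1 - ε)) := by gcongr
      _ = _ := by
        rw [pow_succ, hrdef]
        field_simp
        ring
  have hcoef : ∀ n, 0 ≤ (1 - r ^ n) * (s / κ' / (1 - ε)) := fun n =>
    mul_nonneg (sub_nonneg.2 (pow_le_one₀ hr0.le hr1.le)) (by positivity)
  have links : ∀ n, Link d (ENNReal.ofReal ((1 - r ^ n) * (s / κ' / (1 - ε)))) μ (m n) ∧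
      Link d (ENNReal.ofReal ((1 - r ^ n) * (s / κ' / (1 - ε)))) (m n) μ := by
    intro n
    induction n with
    | zero =>
      rw [hm0]
      exact ⟨(Link.refl hdiag μ).mono zero_le, (Link.refl hdiag μ).mono zero_le⟩
    | succ n ih =>
      have hl := hrev.link_euler hdiag hd hc (ub n) h0.le h1 (hm n)
        (by rw [← usucc]; exact hm (n + 1))
      have hsum : ENNReal.ofReal ((1 - r ^ n) * (s / κ' / (1 - ε))) +
          ENNReal.ofReal (ε * (√(2 * jumpRate K * expect π (fish K (u n))) / (1 - ε))) ≤
          ENNReal.ofReal ((1 - r ^ (n + 1)) * (s / κ' / (1 - ε))) := by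
        rw [← ENNReal.ofReal_add (hcoef n) (by positivity)]
        exact ENNReal.ofReal_le_ofReal (by linarith [cost_le n])
      exact ⟨(ih.1.trans htri hl.1).mono hsum,
        (hl.2.trans htri ih.2).mono ((add_comm _ _).trans_le hsum)⟩
  set δ : ℕ → ℝ := fun n => 2 * (√(2 * C * ((r ^ n) ^ 2 * H)) / κ') with hδ
  have hδ0 : ∀ n, 0 ≤ δ n := fun n => by positivity
  -- The iterate has mean 1, hence differs from 1 by at most its oscillation, which is controlled by
  -- its own decayed supremum of Γ/f.
  have near : ∀ n x, |u n x - 1| ≤ δ n := fun n x => by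
    have osc := h.osc_le hrev hirr hκ' hlt hc hcC (ub n) (uH n)
    have e : u n x - 1 = expect π (fun y => u n x - u n y) := by
      rw [expect_sub _ (.const _) (ub n).bounded, expect_const, uone]
    have b := (Bounded.const (u n x)).sub (ub n).bounded
    rw [e, abs_le]
    exact ⟨le_expect _ b fun y => (abs_le.1 (osc y x)).1,
      expect_le _ b fun y => (abs_le.1 (osc y x)).2⟩
  have tv : ∀ n, ∑' x, ENNReal.ofReal |u n x - 1| * π x ≤ ENNReal.ofReal (δ n) := fun n => by
    calc _ ≤ ∑' x, ENNReal.ofReal (δ n) * π x :=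
          ENNReal.tsum_le_tsum fun x => mul_le_mul_left (ENNReal.ofReal_le_ofReal (near n x)) _
      _ = _ := by rw [ENNReal.tsum_mul_left, π.tsum_coe, mul_one]
  have hlim : Filter.Tendsto (fun n => s / κ' / (1 - ε) + D * √(δ n)) Filter.atTop
      (nhds (s / κ' / (1 - ε))) := by
    have t := tendsto_pow_atTop_nhds_zero_of_lt_one hr0.le hr1
    have c1 : Continuous fun z : ℝ => s / κ' / (1 - ε) +
        D * √(2 * (√(2 * C * (z ^ 2 * H)) / κ')) := by fun_prop
    have hz : s / κ' / (1 - ε) = s / κ' / (1 - ε) +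
        D * √(2 * (√(2 * C * ((0 : ℝ) ^ 2 * H)) / κ')) := by
      simp
    conv => arg 3; rw [hz]
    exact (c1.tendsto 0).comp t
  obtain ⟨n, hn⟩ := (hlim.eventually_lt_const hθε).exists
  have fin : ENNReal.ofReal ((1 - r ^ n) * (s / κ' / (1 - ε))) + ENNReal.ofReal (D * √(δ n)) ≤
      ENNReal.ofReal θ := by
    rw [← ENNReal.ofReal_add (hcoef n) (by positivity)]
    refine ENNReal.ofReal_le_ofReal (le_trans (add_le_add_left ?_ _) hn.le)
    exact mul_le_of_le_one_left (by positivity) (by linarith [pow_pos hr0 n])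
  have tv' : ∑' x, ENNReal.ofReal |1 - u n x| * π x ≤ ENNReal.ofReal (δ n) := by
    simpa only [abs_sub_comm] using tv n
  exact ⟨((links n).1.trans htri
      ((hm n).link_of_le hdiag hD (hasDensity_one π) (hδ0 n) (tv n))).mono fin,
    (((hasDensity_one π).link_of_le hdiag hD (hm n) (hδ0 n) tv').trans htri
      (links n).2).mono ((add_comm _ _).trans_le fin)⟩

/-! ### Truncation and approximation of general densities -/

/-- Truncation of a real number to the interval `[a, b]`. -/
def clamp (a b t : ℝ) : ℝ := max a (min t b)

theorem clamp_mem {a b : ℝ} (hab : a ≤ b) (t : ℝ) : a ≤ clamp a b t ∧ clamp a b t ≤ b :=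
  ⟨le_max_left _ _, max_le hab (min_le_right _ _)⟩

theorem abs_clamp_sub_le (a b s t : ℝ) : |clamp a b t - clamp a b s| ≤ |t - s| := by
  unfold clamp
  refine (abs_max_sub_max_le_max a (min t b) a (min s b)).trans (max_le (by simp) ?_)
  exact (abs_min_sub_min_le_max t b s b).trans (max_le le_rfl (by simp))

/-- For s ≤ b truncation shrinks the difference and does not lower the denominator s. For s > b it
lowers the denominator, but r ↦ (r-t)²/r increases for r ≥ t, so the smaller difference compensates.
-/
theorem sq_clamp_sub_mul_le {a b s t : ℝ} (ha : 0 < a) (hab : a ≤ b) (hs : 0 ≤ s) (ht : 0 ≤ t) :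
    (clamp a b t - clamp a b s) ^ 2 * s ≤ (t - s) ^ 2 * clamp a b s := by
  by_cases hsb : s ≤ b
  · have h1 : s ≤ clamp a b s := by rw [clamp, min_eq_left hsb]; exact le_max_right _ _
    exact mul_le_mul (sq_le_sq.2 (abs_clamp_sub_le a b s t)) h1 hs (sq_nonneg _)
  · push Not at hsb
    have h1 : clamp a b s = b := by rw [clamp, min_eq_right hsb.le, max_eq_right hab]
    rw [h1]
    by_cases htb : b ≤ t
    · have h2 : clamp a b t = b := by rw [clamp, min_eq_right htb, max_eq_right hab]
      rw [h2, sub_self, zero_pow two_ne_zero, zero_mul]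
      exact mul_nonneg (sq_nonneg _) (ha.le.trans hab)
    · push Not at htb
      have h2 : t ≤ clamp a b t := by rw [clamp, min_eq_left htb.le]; exact le_max_right _ _
      have h3 := (clamp_mem hab t).2
      have h4 : (clamp a b t - b) ^ 2 ≤ (t - b) ^ 2 := by nlinarith
      -- The difference of the two sides is (s-b)(sb-t²).
      have h5 : (t - b) ^ 2 * s ≤ (t - s) ^ 2 * b := by
        have : t * t ≤ s * b := mul_le_mul (htb.le.trans hsb.le) htb.le ht hs
        nlinarith [mul_nonneg (sub_nonneg.2 hsb.le) (sub_nonneg.2 this)]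
      exact (mul_le_mul_of_nonneg_right h4 hs).trans h5

theorem ofReal_sq_clamp_div_le {a b s t : ℝ} (ha : 0 < a) (hab : a ≤ b) (hs : 0 ≤ s)
    (ht : 0 ≤ t) :
    ENNReal.ofReal ((clamp a b t - clamp a b s) ^ 2) / ENNReal.ofReal (clamp a b s) ≤
      ENNReal.ofReal ((t - s) ^ 2) / ENNReal.ofReal s := by
  have hpos : 0 < clamp a b s := ha.trans_le (clamp_mem hab s).1
  rcases hs.eq_or_lt with rfl | hs
  · rcases ht.eq_or_lt with rfl | ht
    · simp
    · rw [ENNReal.ofReal_zero, ENNReal.div_zero]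
      · exact le_top
      · rw [sub_zero]
        exact (ENNReal.ofReal_pos.2 (by positivity)).ne'
  · rw [← ENNReal.ofReal_div_of_pos hpos, ← ENNReal.ofReal_div_of_pos hs]
    refine ENNReal.ofReal_le_ofReal ?_
    rw [div_le_div_iff₀ hpos hs]
    exact sq_clamp_sub_mul_le ha hab hs.le ht

theorem eGam_div_eq (f : X → ℝ) (x : X) (t : ℝ≥0∞) :
    eGam K f x / t = (1 / 2) * ∑' y, ENNReal.ofReal ((f y - f x) ^ 2) / t * K x y := by
  rw [eGam, mul_div_assoc, div_eq_mul_inv (tsum _), ← ENNReal.tsum_mul_right]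
  congr 1
  exact tsum_congr fun y => by rw [div_eq_mul_inv]; ring

theorem ofReal_Gam {f : X → ℝ} (hf : Bounded f) (x : X) :
    ENNReal.ofReal (Gam K f f x) = eGam K f x := by
  have b := hf.sub (.const (f x))
  rw [Gam_eq_expect, ENNReal.ofReal_mul (by norm_num),
    ofReal_expect _ (b.mul b) fun y => mul_self_nonneg _, eGam]
  simp only [← pow_two]
  congr 1
  rw [ENNReal.ofReal_div_of_pos two_pos]
  simp

theorem Between.ofReal_expect_fish {f : X → ℝ} {c C : ℝ} (hc : 0 < c) (hf : Between c C f) :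
    ENNReal.ofReal (expect π (fish K f)) = fisherBar K π f := by
  rw [ofReal_expect _ (hf.bounded_fish hc) (hf.fish_nonneg hc), fisherBar]
  refine tsum_congr fun x => ?_
  rw [fish, ENNReal.ofReal_div_of_pos (hc.trans_le (hf x).1), ofReal_Gam hf.bounded]

theorem fisherBar_clamp_le {a b : ℝ} (ha : 0 < a) (hab : a ≤ b) {f : X → ℝ}
    (hf : ∀ x, 0 ≤ f x) : fisherBar K π (fun x => clamp a b (f x)) ≤ fisherBar K π f := by
  refine ENNReal.tsum_le_tsum fun x => mul_le_mul_left ?_ _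
  rw [eGam_div_eq, eGam_div_eq]
  exact mul_le_mul_right (ENNReal.tsum_le_tsum fun y => mul_le_mul_left
    (ofReal_sq_clamp_div_le ha hab (hf x) (hf y)) _) _

theorem fish_const_mul (f : X → ℝ) (t : ℝ) (x : X) :
    fish K (fun y => t * f y) x = t * fish K f x := by
  have e : Gam K (fun y => t * f y) (fun y => t * f y) x = t ^ 2 * Gam K f f x := by
    have : (fun y => (t * f y - t * f x) * (t * f y - t * f x)) =
        fun y => t ^ 2 * ((f y - f x) * (f y - f x)) := by
      ext y; ring
    rw [Gam_eq_expect, this, expect_const_mul, Gam_eq_expect]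
    ring
  rw [fish, e, fish]
  by_cases ht : t = 0
  · simp [ht]
  · rw [pow_two, mul_assoc, mul_div_mul_left _ _ ht, mul_div_assoc]

/-- Without jumps Γ vanishes. This rules out the product 0·∞ on the right side of the main
inequality. -/
theorem fisherBar_eq_zero_of_jumpRate_eq_zero (hJ : jumpRate K = 0) (f : X → ℝ) :
    fisherBar K π f = 0 := by
  have hK : ∀ x y, y ≠ x → K x y = 0 := fun x y hy => by
    have h1 : (K x x).toReal = 1 :=
      le_antisymm (toReal_apply_le_one _ _) (by linarith [le_jumpRate K x])
    have h2 : K x x = 1 := (ENNReal.toReal_eq_one_iff _).1 h1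
    rw [PMF.apply_eq_one_iff] at h2
    rw [PMF.apply_eq_zero_iff, h2]
    exact hy
  have h0 : ∀ x, eGam K f x = 0 := fun x => by
    rw [eGam, ENNReal.tsum_eq_zero.2 fun y => ?_, mul_zero]
    by_cases hy : y = x
    · simp [hy]
    · simp [hK x y hy]
  simp [fisherBar, h0]

/-- A bound independent of the truncation levels, to serve as the dominating function f + 1. -/
theorem abs_sub_clamp_le {a b t : ℝ} (ha : 0 ≤ a) (ha1 : a ≤ 1) (hb : 0 ≤ b) (ht : 0 ≤ t) :
    |t - clamp a b t| ≤ t + 1 := by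
  rw [clamp]
  have h1 : 0 ≤ min t b := le_min ht hb
  have h2 : min t b ≤ t := min_le_left _ _
  have h3 : max a (min t b) ≤ t + 1 := max_le (by linarith) (by linarith)
  have h4 : 0 ≤ max a (min t b) := ha.trans (le_max_left _ _)
  rw [abs_le]
  constructor <;> linarith [le_max_right a (min t b)]

theorem tendsto_clamp {t : ℝ} (ht : 0 ≤ t) : Filter.Tendsto
    (fun n : ℕ => clamp (1 / ((n : ℝ) + 1)) ((n : ℝ) + 1) t) Filter.atTop (nhds t) := by
  have h : (fun n : ℕ => max (1 / ((n : ℝ) + 1)) t) =ᶠ[Filter.atTop]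
      fun n : ℕ => clamp (1 / ((n : ℝ) + 1)) ((n : ℝ) + 1) t := by
    filter_upwards [Filter.eventually_ge_atTop ⌈t⌉₊] with n hn
    have : t ≤ (n : ℝ) + 1 := by linarith [Nat.ceil_le.1 hn]
    rw [clamp, min_eq_left this]
  refine Filter.Tendsto.congr' h ?_
  have := (tendsto_one_div_add_atTop_nhds_zero_nat (𝕜 := ℝ)).max
    (tendsto_const_nhds (x := t))
  rwa [max_eq_right ht] at this

/-- A probability density is approximated in `L¹` by densities bounded above and below, without
a substantial increase of the modified Fisher information. -/
theorem exists_approx {f : X → ℝ} (hf : ∀ x, 0 ≤ f x) {ν : PMF X} (hν : HasDensity π f ν)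
    (hI : fisherBar K π f ≠ ∞) : ∃ (g : ℕ → X → ℝ) (e : ℕ → ℝ) (Z : ℕ → ℝ),
      Filter.Tendsto e Filter.atTop (nhds 0) ∧ Filter.Tendsto Z Filter.atTop (nhds 1) ∧
      ∀ n, 0 ≤ e n ∧ 0 < Z n ∧ (∃ c > 0, ∃ C ≥ c, Between c C (g n)) ∧ expect π (g n) = 1 ∧
        expect π (fish K (g n)) ≤ (fisherBar K π f).toReal / Z n ∧
        ∑' x, ENNReal.ofReal |f x - g n x| * π x ≤ ENNReal.ofReal (e n) := by
  set φ : ℕ → X → ℝ := fun n x => clamp (1 / ((n : ℝ) + 1)) ((n : ℝ) + 1) (f x) with hφ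
  have ha : ∀ n : ℕ, (0 : ℝ) < 1 / ((n : ℝ) + 1) := fun n => by positivity
  have ha1 : ∀ n : ℕ, 1 / ((n : ℝ) + 1) ≤ 1 := fun n =>
    (div_le_one (by positivity)).2 (by linarith [(Nat.cast_nonneg n : (0 : ℝ) ≤ n)])
  have hab : ∀ n : ℕ, 1 / ((n : ℝ) + 1) ≤ (n : ℝ) + 1 := fun n =>
    (ha1 n).trans (by linarith [(Nat.cast_nonneg n : (0 : ℝ) ≤ n)])
  have φb : ∀ n : ℕ, Between (1 / ((n : ℝ) + 1)) ((n : ℝ) + 1) (φ n) := fun n x => clamp_mem (hab n) _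
  have hfν : ∀ x, f x * (π x).toReal = (ν x).toReal := fun x => by
    rw [hν x, ENNReal.toReal_mul, ENNReal.toReal_ofReal (hf x)]
  have fsum : Summable fun x => f x * (π x).toReal := by
    simp only [hfν]
    exact summable_toReal ν
  have fone : ∑' x, f x * (π x).toReal = 1 := by
    simp only [hfν]
    exact tsum_toReal ν
  have bsum : Summable fun x => (f x + 1) * (π x).toReal := by
    simp only [add_mul, one_mul]
    exact fsum.add (summable_toReal π)
  have wle : ∀ n x, |f x - φ n x| * (π x).toReal ≤ (f x + 1) * (π x).toReal := fun n x =>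
    mul_le_mul_of_nonneg_right (abs_sub_clamp_le (ha n).le (ha1 n) (by positivity) (hf x))
      ENNReal.toReal_nonneg
  have wsum : ∀ n, Summable fun x => |f x - φ n x| * (π x).toReal := fun n =>
    bsum.of_nonneg_of_le (fun x => mul_nonneg (abs_nonneg _) ENNReal.toReal_nonneg) (wle n)
  set w : ℕ → ℝ := fun n => ∑' x, |f x - φ n x| * (π x).toReal with hw
  have hw0 : ∀ n, 0 ≤ w n := fun n =>
    tsum_nonneg fun x => mul_nonneg (abs_nonneg _) ENNReal.toReal_nonneg
  have wlim : Filter.Tendsto w Filter.atTop (nhds 0) := by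
    have := tendsto_tsum_of_dominated_convergence (𝓕 := Filter.atTop)
      (f := fun n x => |f x - φ n x| * (π x).toReal) (g := fun _ => (0 : ℝ)) bsum (fun x => by
        have := ((tendsto_const_nhds (x := f x)).sub (tendsto_clamp (hf x))).abs.mul_const
          (π x).toReal
        simpa only [sub_self, abs_zero, zero_mul] using this) (Filter.Eventually.of_forall fun n x => by
        rw [Real.norm_of_nonneg (mul_nonneg (abs_nonneg _) ENNReal.toReal_nonneg)]
        exact wle n x)
    simpa using this
  set Z : ℕ → ℝ := fun n => expect π (φ n) with hZ
  have Zpos : ∀ n, 0 < Z n := fun n =>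
    (ha n).trans_le (le_expect π (φb n).bounded fun x => (φb n x).1)
  have Zw : ∀ n, |1 - Z n| ≤ w n := fun n => by
    have e : 1 - Z n = ∑' x, (f x - φ n x) * (π x).toReal := by
      simp only [sub_mul]
      rw [fsum.tsum_sub ((φb n).bounded.summable π), fone]
      rfl
    have en : ∀ x, ‖(f x - φ n x) * (π x).toReal‖ = |f x - φ n x| * (π x).toReal := fun x => by
      rw [norm_mul, Real.norm_eq_abs, Real.norm_of_nonneg ENNReal.toReal_nonneg]
    rw [e, ← Real.norm_eq_abs]
    refine (norm_tsum_le_tsum_norm ?_).trans (le_of_eq ?_)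
    · simpa only [en] using wsum n
    · simp only [en, hw]
  have Zlim : Filter.Tendsto Z Filter.atTop (nhds 1) := by
    have : Filter.Tendsto (fun n => 1 - Z n) Filter.atTop (nhds 0) :=
      squeeze_zero_norm Zw wlim
    simpa using (tendsto_const_nhds (x := (1 : ℝ))).sub this
  -- The L¹ error is w n for truncating plus |1 - Z n| ≤ w n for normalising. As Γ(f)/f is
  -- homogeneous of degree one, normalising divides the Fisher information by Z n.
  refine ⟨fun n x => (Z n)⁻¹ * φ n x, fun n => 2 * w n, Z, by simpa using wlim.const_mul 2, Zlim,
    fun n => ⟨by linarith [hw0 n], Zpos n, ?_, ?_, ?_, ?_⟩⟩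
  · refine ⟨(Z n)⁻¹ * (1 / ((n : ℝ) + 1)), mul_pos (inv_pos.2 (Zpos n)) (ha n),
      (Z n)⁻¹ * ((n : ℝ) + 1),
      mul_le_mul_of_nonneg_left (hab n) (inv_pos.2 (Zpos n)).le, fun x =>
      ⟨mul_le_mul_of_nonneg_left (φb n x).1 (inv_pos.2 (Zpos n)).le,
        mul_le_mul_of_nonneg_left (φb n x).2 (inv_pos.2 (Zpos n)).le⟩⟩
  · rw [expect_const_mul]
    exact inv_mul_cancel₀ (Zpos n).ne'
  · have e : fish K (fun x => (Z n)⁻¹ * φ n x) = fun x => (Z n)⁻¹ * fish K (φ n) x :=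
      funext fun x => fish_const_mul _ _ _
    rw [e, expect_const_mul, div_eq_inv_mul]
    refine mul_le_mul_of_nonneg_left ?_ (inv_pos.2 (Zpos n)).le
    rw [← ENNReal.ofReal_le_iff_le_toReal hI, (φb n).ofReal_expect_fish (ha n)]
    exact fisherBar_clamp_le (ha n) (hab n) hf
  · have hle : ∀ x, |f x - (Z n)⁻¹ * φ n x| ≤ |f x - φ n x| + |1 - Z n| * ((Z n)⁻¹ * φ n x) :=
      fun x => by
        have hφ0 : 0 ≤ (Z n)⁻¹ * φ n x :=
          mul_nonneg (inv_pos.2 (Zpos n)).le ((ha n).le.trans (φb n x).1)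
        have e : f x - (Z n)⁻¹ * φ n x =
            (f x - φ n x) + -((1 - Z n) * ((Z n)⁻¹ * φ n x)) := by
          have := (Zpos n).ne'
          field_simp
          ring
        rw [e]
        refine (abs_add_le _ _).trans (le_of_eq ?_)
        rw [abs_neg, abs_mul (1 - Z n), abs_of_nonneg hφ0]
    have bg : Bounded (fun x => |1 - Z n| * ((Z n)⁻¹ * φ n x)) :=
      ((φb n).bounded.const_mul _).const_mul _
    have gsum := bg.summable π
    have gval : ∑' x, |1 - Z n| * ((Z n)⁻¹ * φ n x) * (π x).toReal = |1 - Z n| := by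
      change expect π (fun x => |1 - Z n| * ((Z n)⁻¹ * φ n x)) = _
      rw [expect_const_mul, expect_const_mul]
      change |1 - Z n| * ((Z n)⁻¹ * Z n) = _
      rw [inv_mul_cancel₀ (Zpos n).ne', mul_one]
    have hle' : ∀ x, |f x - (Z n)⁻¹ * φ n x| * (π x).toReal ≤
        |f x - φ n x| * (π x).toReal + |1 - Z n| * ((Z n)⁻¹ * φ n x) * (π x).toReal := fun x => by
      rw [← add_mul]
      exact mul_le_mul_of_nonneg_right (hle x) ENNReal.toReal_nonneg
    have nn : ∀ x, 0 ≤ |f x - (Z n)⁻¹ * φ n x| * (π x).toReal := fun x =>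
      mul_nonneg (abs_nonneg _) ENNReal.toReal_nonneg
    have ssum := ((wsum n).add gsum).of_nonneg_of_le nn hle'
    have hreal : ∑' x, |f x - (Z n)⁻¹ * φ n x| * (π x).toReal ≤ 2 * w n := by
      refine (ssum.tsum_le_tsum hle' ((wsum n).add gsum)).trans ?_
      rw [(wsum n).tsum_add gsum, gval]
      have := Zw n
      change w n + _ ≤ _
      linarith
    refine le_trans (le_of_eq ?_) (ENNReal.ofReal_le_ofReal hreal)
    rw [ENNReal.ofReal_tsum_of_nonneg nn ssum]
    refine tsum_congr fun x => ?_
    rw [ENNReal.ofReal_mul (abs_nonneg _), ENNReal.ofReal_toReal (π.apply_ne_top x)]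

/-! ### General densities and conclusion -/

theorem CDEPrime.link_of_lt {κ θ : ℝ} (h : CDEPrime K κ) (hrev : Reversible K π)
    (hirr : Irreducible K) (hκ : 0 < κ) {d : X → X → ℝ≥0∞} (hdiag : ∀ x, d x x = 0)
    (htri : ∀ x y z, d x z ≤ d x y + d y z) (hd : ∀ x y, 0 < K x y → d x y ≤ 1) {D : ℕ}
    (hD : ∀ x y, d x y ≤ D) {f : X → ℝ} (hf : ∀ x, 0 ≤ f x) {ν : PMF X}
    (hν : HasDensity π f ν) (hI : fisherBar K π f ≠ ∞)
    (hθ : √(2 * jumpRate K * (fisherBar K π f).toReal) / κ < θ) :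
    Link d (ENNReal.ofReal θ) ν π ∧ Link d (ENNReal.ofReal θ) π ν := by
  obtain ⟨g, e, Z, elim, Zlim, hg⟩ := exists_approx hf hν hI
  have hJ := jumpRate_nonneg K
  have lim : Filter.Tendsto (fun n =>
      √(2 * jumpRate K * ((fisherBar K π f).toReal / Z n)) / κ + D * √(e n)) Filter.atTop
      (nhds (√(2 * jumpRate K * (fisherBar K π f).toReal) / κ)) := by
    have t1 := ((((tendsto_const_nhds (x := (fisherBar K π f).toReal)).div Zlim
      one_ne_zero).const_mul (2 * jumpRate K)).sqrt.div_const κ).add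
      (elim.sqrt.const_mul (D : ℝ))
    simpa using t1
  obtain ⟨n, hn⟩ := (lim.eventually_lt_const hθ).exists
  obtain ⟨he0, hZ, ⟨c, hc, C, hcC, hb⟩, h1, hfi, htv⟩ := hg n
  obtain ⟨μ, hμ⟩ := exists_hasDensity hb.bounded (fun x => hc.le.trans (hb x).1) h1
  -- The budget θ is split: D√(e n) pays for passing between f and its approximation, the rest for
  -- the bounded density.
  have hs : √(2 * jumpRate K * expect π (fish K (g n))) / κ < θ - D * √(e n) := by
    refine lt_of_le_of_lt ?_ (lt_sub_iff_add_lt.2 hn)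
    gcongr
  have hl := h.link_of_between hrev hirr hκ hdiag htri hd hD hc hcC hb h1 hμ hs
  have hpos : 0 ≤ θ - D * √(e n) := le_trans (by positivity) hs.le
  have hsum : ENNReal.ofReal (D * √(e n)) + ENNReal.ofReal (θ - D * √(e n)) ≤
      ENNReal.ofReal θ := by
    rw [← ENNReal.ofReal_add (by positivity) hpos, add_sub_cancel]
  have htv' : ∑' x, ENNReal.ofReal |g n x - f x| * π x ≤ ENNReal.ofReal (e n) := by
    simpa only [abs_sub_comm] using htv
  exact ⟨((hν.link_of_le hdiag hD hμ he0 htv).trans htri hl.1).mono hsum,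
    (hl.2.trans htri (hμ.link_of_le hdiag hD hν he0 htv')).mono ((add_comm _ _).trans_le hsum)⟩

end DiscreteChain

theorem theorem4p3 {X : Type*} [Countable X] (K : X → PMF X) (π : PMF X)
    (hirr : DiscreteChain.Irreducible K) (hrev : DiscreteChain.Reversible K π)
    (κ : ℝ) (hκ : 0 < κ) (hcurv : DiscreteChain.CDEPrime K κ)
    (f : X → ℝ) (hf : ∀ x, 0 ≤ f x)
    (ν : PMF X) (hν : ∀ x, ν x = ENNReal.ofReal (f x) * π x) :
    DiscreteChain.graphWeakCost K π ν ≤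
        ENNReal.ofReal (2 * DiscreteChain.jumpRate K / κ ^ 2) * DiscreteChain.fisherBar K π f ∧
      DiscreteChain.graphWeakCost K ν π ≤
        ENNReal.ofReal (2 * DiscreteChain.jumpRate K / κ ^ 2) * DiscreteChain.fisherBar K π f := by
  have hJ := DiscreteChain.jumpRate_nonneg K
  by_cases hI : DiscreteChain.fisherBar K π f = ∞
  · have hJ0 : DiscreteChain.jumpRate K ≠ 0 := fun h0 => by
      rw [DiscreteChain.fisherBar_eq_zero_of_jumpRate_eq_zero h0] at hI
      exact ENNReal.zero_ne_top hI
    have hpos : 0 < 2 * DiscreteChain.jumpRate K / κ ^ 2 := by positivity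
    rw [hI, ENNReal.mul_top (ENNReal.ofReal_pos.2 hpos).ne']
    exact ⟨le_top, le_top⟩
  obtain ⟨D, hD⟩ := hcurv.exists_dist_le hrev hirr hκ
  have : Nonempty X := π.support_nonempty.to_type
  have hconn := hirr.connected
  set I := (DiscreteChain.fisherBar K π f).toReal with hIdef
  set s := √(2 * DiscreteChain.jumpRate K * I) / κ with hs
  have key : ∀ θ, s < θ →
      DiscreteChain.graphWeakCost K π ν ≤ ENNReal.ofReal θ ^ 2 ∧
      DiscreteChain.graphWeakCost K ν π ≤ ENNReal.ofReal θ ^ 2 := fun θ hθ => by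
    have hl := hcurv.link_of_lt (d := fun x y => ((DiscreteChain.graph K).dist x y : ℝ≥0∞))
      hrev hirr hκ (fun x => by simp) (fun x y z => by exact_mod_cast hconn.dist_triangle)
      (fun x y hxy => by exact_mod_cast DiscreteChain.graph_dist_le_one hxy) (D := D)
      (fun x y => by exact_mod_cast hD x y) hf hν hI hθ
    exact ⟨hl.1.weakCost_le, hl.2.weakCost_le⟩
  have hval : ENNReal.ofReal s ^ 2 = ENNReal.ofReal (2 * DiscreteChain.jumpRate K / κ ^ 2) *
      DiscreteChain.fisherBar K π f := by
    rw [← ENNReal.ofReal_toReal hI, ← ENNReal.ofReal_mul (by positivity),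
      ← ENNReal.ofReal_pow (by positivity), hs, div_pow, Real.sq_sqrt (by positivity)]
    congr 1
    ring
  -- Couplings exist only for θ > s; the infimum defining the cost survives the limit θ ↓ s.
  have lim : Filter.Tendsto (fun θ => ENNReal.ofReal θ ^ 2) (nhdsWithin s (Set.Ioi s))
      (nhds (ENNReal.ofReal s ^ 2)) :=
    (((ENNReal.continuous_pow 2).comp ENNReal.continuous_ofReal).tendsto s).mono_left
      nhdsWithin_le_nhds
  rw [← hval]
  exact ⟨ge_of_tendsto lim (eventually_nhdsWithin_of_forall fun θ hθ => (key θ hθ).1),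
    ge_of_tendsto lim (eventually_nhdsWithin_of_forall fun θ hθ => (key θ hθ).2)⟩
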